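/- Let $\widehat G$ be a finite group, $\pi:\widehat G\to C_2=\{1,-1\}$ a surjective homomorphism and $G=\ker\pi$, a subgroup of index $2$; elements of $G$ are called even and elements of $\widehat G\setminus G$ odd. Let $\mathbb C{\ast}\widehat G$ be the skew group algebra: the complex vector space with basis $\widehat G$ and multiplication $a\mathbf g\cdot b\mathbf h=a\,({}^{\pi(\mathbf g)}b)\,\mathbf g\mathbf h$ for $a,b\in\mathbb C$, where ${}^{1}b=b$ and ${}^{-1}b=\overline b$. It is an $\mathbb R$-algebra containing $\mathbb C G$, $\mathbb R\widehat G$ and $\mathbb R G$. For a primitive central idempotent $e$ of $\mathbb R G$ and an odd $\mathbf w$ put $f=e$ if $\mathbf w e\mathbf w^{-1}=e$, and $f=e+\mathbf w e\mathbf w^{-1}$ otherwise (this does not depend on $\mathbf w$). The A-block of $f$ consists of the algebras $f\mathbb R G$, $f\mathbb R\widehat G$, $f\mathbb C G$ and $f(\mathbb C{\ast}\widehat G)$. A $\mathbb C G$-module $V$ and a $\mathbb C{\ast}\widehat G$-module $W$ are in the same A-block if, for some such $f$, they are modules over $f\mathbb C G$ and $f(\mathbb C{\ast}\widehat G)$ respectively,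 i.e. $f$ acts as the identity on both. A simple $\mathbb C{\ast}\widehat G$-module $W$ is of type $\mathbb F\in\{\mathbb R,\mathbb C,\mathbb H\}$ if $\operatorname{End}_{\mathbb C{\ast}\widehat G}(W)\cong\mathbb F$ as $\mathbb R$-algebras. **Theorem (Bargmann–Frobenius–Schur criterion).** Let $\chi$ be the character of a simple $\mathbb C G$-module $V$, and let $W$ be a simple $\mathbb C{\ast}\widehat G$-module in the same A-block as $V$. Then $W$ is of type $\mathbb R$, $\mathbb C$ or $\mathbb H$, and $$\mathcal F(\chi):=\frac1{|G|}\sum_{\mathbf z\in\widehat G\setminus G}\chi(\mathbf z^2)=\begin{cases}1&\text{if }W\text{ is of type }\mathbb R,\\ 0&\text{if }W\text{ is of type }\mathbb C,\\ -1&\text{if }W\text{ is of type }\mathbb H.\end{cases}$$ -/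

import Mathlib

/-!
Real (antilinear) representation theory of a `C₂`-graded group.

A `C₂`-graded group is given by a group `Ĝ` and a surjective homomorphism `π : Ĝ →* ℤˣ`
(`ℤˣ = {1, -1}`).  Its ungraded subgroup is `G = π.ker`; an element `z` is odd if `π z = -1`.
-/

/-- The group `Ĝ`, remembering its grading `π`, so that it can act on `ℂ` through `π`. -/
def Graded {Gh : Type*} [Group Gh] (_π : Gh →* ℤˣ) : Type _ := Gh

instance Graded.instGroup {Gh : Type*} [Group Gh] (π : Gh →* ℤˣ) : Group (Graded π) :=
  inferInstanceAs (Group Gh)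

/-- The identity isomorphism from `Graded π` to `Ĝ`. -/
def Graded.toGroup {Gh : Type*} [Group Gh] (π : Gh →* ℤˣ) : Graded π ≃* Gh :=
  MulEquiv.refl Gh

/-- Even elements act on `ℂ` trivially, odd elements act by complex conjugation. -/
noncomputable instance Graded.instMulSemiringAction {Gh : Type*} [Group Gh] (π : Gh →* ℤˣ) :
    MulSemiringAction (Graded π) ℂ where
  smul z a := if π (Graded.toGroup π z) = 1 then a else (starRingEnd ℂ) a
  one_smul a := if_pos (by rw [map_one, map_one])
  mul_smul y z a := by
    simp only [HSMul.hSMul, map_mul]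
    rcases Int.units_eq_one_or (π (Graded.toGroup π y)) with hy | hy <;>
      rcases Int.units_eq_one_or (π (Graded.toGroup π z)) with hz | hz <;> simp [hy, hz]
  smul_zero z := by
    simp only [HSMul.hSMul]
    simp
  smul_add z a b := by
    simp only [HSMul.hSMul]
    split_ifs <;> simp
  smul_one z := by
    simp only [HSMul.hSMul]
    simp
  smul_mul z a b := by
    simp only [HSMul.hSMul]
    split_ifs <;> simp

theorem Graded.smul_def {Gh : Type*} [Group Gh] (π : Gh →* ℤˣ) (z : Graded π) (a : ℂ) :
    z • a = if π (Graded.toGroup π z) = 1 then a else (starRingEnd ℂ) a := rfl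

instance Graded.instSMulCommClass {Gh : Type*} [Group Gh] (π : Gh →* ℤˣ) :
    SMulCommClass (Graded π) ℝ ℂ where
  smul_comm z r a := by
    simp only [Graded.smul_def]
    split_ifs <;> simp

/-- The skew group algebra `ℂ ∗ Ĝ`: complex vector space with basis `Ĝ` and multiplication
`(a g) (b h) = a (ᵍb) gh`, where `ᵍb` is `b` for even `g` and the conjugate of `b` for odd `g`.
It is an `ℝ`-algebra.  Its modules are the antilinear representations. -/
abbrev SkewGroupAlgebra {Gh : Type*} [Group Gh] (π : Gh →* ℤˣ) : Type _ :=
  SkewMonoidAlgebra ℂ (Graded π)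

/-- The inclusion `ℝĜ → ℂ ∗ Ĝ`. -/
noncomputable def realToSkew {Gh : Type*} [Group Gh] (π : Gh →* ℤˣ) :
    MonoidAlgebra ℝ Gh →ₐ[ℝ] SkewGroupAlgebra π :=
  MonoidAlgebra.lift ℝ (SkewGroupAlgebra π) Gh
    ((SkewMonoidAlgebra.of ℂ (Graded π)).comp (Graded.toGroup π).symm.toMonoidHom)

/-- The inclusion `ℝG → ℝĜ`. -/
noncomputable def evenToReal {Gh : Type*} [Group Gh] (π : Gh →* ℤˣ) :
    MonoidAlgebra ℝ π.ker →ₐ[ℝ] MonoidAlgebra ℝ Gh :=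
  MonoidAlgebra.mapDomainAlgHom ℝ ℝ π.ker.subtype

/-- The inclusion `ℝG → ℂG`. -/
noncomputable def realToComplex (G : Type*) [Group G] :
    MonoidAlgebra ℝ G →ₐ[ℝ] MonoidAlgebra ℂ G :=
  MonoidAlgebra.mapAlgHom G (Algebra.ofId ℝ ℂ)

/-- The automorphism `ξ : x ↦ w x w⁻¹` of `ℝG`, for `w ∈ Ĝ`. -/
noncomputable def conjReal {Gh : Type*} [Group Gh] (π : Gh →* ℤˣ) (w : Gh) :
    MonoidAlgebra ℝ π.ker ≃ₐ[ℝ] MonoidAlgebra ℝ π.ker :=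
  MonoidAlgebra.domCongr ℝ ℝ (MulAut.conjNormal w)

/-- Primitive central idempotents of a ring. -/
def IsPrimitiveCentralIdempotent {R : Type*} [Ring R] (e : R) : Prop :=
  IsIdempotentElem e ∧ e ∈ Subring.center R ∧ e ≠ 0 ∧
    ∀ c : R, IsIdempotentElem c → c ∈ Subring.center R → c * e = c → c = 0 ∨ c = e

open Classical in
/-- The idempotent of `ℝG` that cuts out the A-block of a primitive central idempotent `e` of `ℝG`:
it is `e` if `ξ e = e` and `e + ξ e` otherwise, where `ξ` is conjugation by an odd element `w`
(the choice of `w` does not matter). -/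
noncomputable def blockIdempotent {Gh : Type*} [Group Gh] (π : Gh →* ℤˣ) (w : Gh)
    (e : MonoidAlgebra ℝ π.ker) : MonoidAlgebra ℝ π.ker :=
  if conjReal π w e = e then e else e + conjReal π w e

/-- The `ℂG`-module `V` and the `ℂ ∗ Ĝ`-module `W` lie in the same A-block: for one of the block
idempotents `f`, `V` is a module over `f ℂG` and `W` is a module over `f (ℂ ∗ Ĝ)`, that is, `f`
acts on both as the identity. -/
def InSameABlock {Gh : Type*} [Group Gh] (π : Gh →* ℤˣ)
    (V : Type*) [AddCommGroup V] [Module (MonoidAlgebra ℂ π.ker) V]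
    (W : Type*) [AddCommGroup W] [Module (SkewGroupAlgebra π) W] : Prop :=
  ∃ (e : MonoidAlgebra ℝ π.ker) (w : Gh), IsPrimitiveCentralIdempotent e ∧ π w = -1 ∧
    (∀ v : V, realToComplex π.ker (blockIdempotent π w e) • v = v) ∧
    (∀ x : W, realToSkew π (evenToReal π (blockIdempotent π w e)) • x = x)

/-- The `ℂ ∗ Ĝ`-module `W` is of type `F`: its endomorphism algebra is isomorphic to `F`. -/
def IsOfType {Gh : Type*} [Group Gh] (π : Gh →* ℤˣ)
    (W : Type*) [AddCommGroup W] [Module ℝ W] [Module (SkewGroupAlgebra π) W]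
    [IsScalarTower ℝ (SkewGroupAlgebra π) W]
    (F : Type*) [Ring F] [Algebra ℝ F] : Prop :=
  Nonempty (Module.End (SkewGroupAlgebra π) W ≃ₐ[ℝ] F)

/-- The character of a `ℂG`-module. -/
noncomputable def moduleCharacter (G : Type*) [Group G]
    (V : Type*) [AddCommGroup V] [Module ℂ V] [Module (MonoidAlgebra ℂ G) V]
    [IsScalarTower ℂ (MonoidAlgebra ℂ G) V] (g : G) : ℂ :=
  LinearMap.trace ℂ V (Algebra.lsmul ℂ ℂ V (MonoidAlgebra.of ℂ G g))

/-- The square of any element of `Ĝ`, as an element of `G`. -/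
def sqEven {Gh : Type*} [Group Gh] (π : Gh →* ℤˣ) (z : Gh) : π.ker :=
  ⟨z ^ 2, by rw [MonoidHom.mem_ker, map_pow, Int.units_sq]⟩

/-- The Real Frobenius–Schur indicator `(1/|G|) ∑_{z odd} χ(z²)`. -/
noncomputable def realFSIndicator {Gh : Type*} [Group Gh] [Fintype Gh] (π : Gh →* ℤˣ)
    (χ : π.ker → ℂ) : ℂ :=
  (1 / (Nat.card π.ker : ℂ)) * ∑ z : Gh with π z = -1, χ (sqEven π z)

/-! ### Frobenius' theorem by means of a positive involution -/

section Frobenius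

/-! The operators of `z` and `i z` on `W`, for `z ∈ Ĝ`, are closed under multiplication up to sign,
so averaging gives an inner product for which they are all orthogonal. Let `τ` be the adjoint and
`D` the commutant `End(W)`. By Schur, nonzero elements of `D` are injective; a self-adjoint element
has a real eigenvalue, so in `D` it is a real scalar. Hence `D` is `ℝ`, `ℂ` or `ℍ`, and `τ` has
trace `1 - (dim D - 1) = 2 - dim D` on `D`.

The map `X ↦ ∑ γ τ(X) τ(γ)` on `End_ℝ W` takes values in `D` and is `2|Ĝ| τ` on `D`, while its trace
is `∑ tr(γ²)`. Since `(i z)² = -z²` for even `z` and `(i z)² = z²` for odd `z`, the even terms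
cancel, and `∑ γ² = 2Ω` with `Ω = ∑ z²` over odd `z`. Moreover `Ω` is a self-adjoint element of `D`,
so it acts by a real `r` with `r dim_ℝ W = |Ĝ| (2 - dim D)` (`skew_frobeniusSchur`).

An element of `ℝG` invariant under conjugation by `Ĝ` that acts on `W` by a real scalar acts on `V`
by the same one (`InSameABlock.smul_eq`). For `Ω` this gives `F(χ) = r dim V / |G|`. For the sum of
all commutators, whose scalar on a simple module is `(|G| / dim)²`, it shows that the simple
`ℂG`-constituents of `W` have the dimension of `V`. In type `ℝ` the restriction of `W` to `ℂG` is
simple; in type `ℍ` it is `U ⊕ wU` with `U` simple. So `dim_ℝ W` is `2 dim V` or `4 dim V`, and `|Ĝ|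
= 2|G|` gives the values `1` and `-1`. In type `ℂ` already `r = 0`. -/

theorem eq_zero_of_mul_eq_zero_of_mul_self {D : Type*} [Ring D] {x y : D} (hy : y * y = -1)
    (e : x * y = 0) : x = 0 := by
  have : x * y * y = -x := by rw [mul_assoc, hy, mul_neg, mul_one]
  rw [e, zero_mul] at this
  simpa using this.symm

variable {D : Type*} [Ring D] [Algebra ℝ D]

/-- A positive involution of a real algebra all of whose fixed points are scalars. -/
structure IsScalarInvolution (τ : D →ₗ[ℝ] D) : Prop where
  map_mul : ∀ a b, τ (a * b) = τ b * τ a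
  involutive : ∀ a, τ (τ a) = a
  eq_scalar : ∀ a, τ a = a → ∃ r : ℝ, a = algebraMap ℝ D r
  pos : ∀ a, a ≠ 0 → ∃ r : ℝ, 0 < r ∧ a * τ a = algebraMap ℝ D r

namespace IsScalarInvolution

variable {τ : D →ₗ[ℝ] D} (h : IsScalarInvolution τ)
include h

theorem map_one : τ 1 = 1 := by
  have h1 := h.map_mul (τ 1) 1
  rw [mul_one, h.involutive, mul_one] at h1
  exact h1.symm

theorem map_algebraMap (r : ℝ) : τ (algebraMap ℝ D r) = algebraMap ℝ D r := by
  rw [Algebra.algebraMap_eq_smul_one, map_smul, h.map_one]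

theorem exists_add_skew (a : D) : ∃ (r : ℝ) (x : D), τ x = -x ∧ a = algebraMap ℝ D r + x := by
  obtain ⟨r, hr⟩ := h.eq_scalar (a + τ a) (by rw [map_add, h.involutive, add_comm])
  refine ⟨r / 2, a - algebraMap ℝ D (r / 2), ?_, by abel⟩
  rw [map_sub, h.map_algebraMap]
  have h2 : algebraMap ℝ D r = algebraMap ℝ D (r / 2) + algebraMap ℝ D (r / 2) := by
    rw [← _root_.map_add, add_halves]
  rw [h2] at hr
  have : τ a = algebraMap ℝ D (r / 2) + algebraMap ℝ D (r / 2) - a := by rw [← hr]; abel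
  rw [this]; abel

/-- The anticommutator is fixed by `τ`, hence scalar. It serves as a symmetric bilinear form on the
skew elements, so the quaternion units can be found by Gram–Schmidt. -/
theorem exists_anticomm {x y : D} (hx : τ x = -x) (hy : τ y = -y) :
    ∃ r : ℝ, x * y + y * x = algebraMap ℝ D r :=
  h.eq_scalar _ (by rw [map_add, h.map_mul, h.map_mul, hx, hy, neg_mul_neg, neg_mul_neg, add_comm])

theorem exists_unit {x : D} (hx : τ x = -x) (h0 : x ≠ 0) :
    ∃ r : ℝ, (r • x) * (r • x) = -1 := by
  obtain ⟨s, hs, e⟩ := h.pos x h0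
  refine ⟨(√s)⁻¹, ?_⟩
  have e' : x * x = -(s • (1 : D)) := by
    rw [hx, mul_neg] at e
    rw [← Algebra.algebraMap_eq_smul_one, ← e, neg_neg]
  rw [smul_mul_smul_comm, e', smul_neg, smul_smul, ← mul_inv, Real.mul_self_sqrt hs.le,
    inv_mul_cancel₀ hs.ne', one_smul]

theorem exists_orthogonal {x y : D} (hx : τ x = -x) (hy : τ y = -y) (hyy : y * y = -1) :
    ∃ r : ℝ, (x - r • y) * y + y * (x - r • y) = 0 := by
  obtain ⟨r, hr⟩ := h.exists_anticomm hx hy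
  -- As `y² = -1`, adding `(r/2) y` to `x` changes the anticommutator `r` by `r y² = -r`.
  refine ⟨-(r / 2), ?_⟩
  have : (x - (-(r / 2)) • y) * y + y * (x - (-(r / 2)) • y)
      = (x * y + y * x) + r • (y * y) := by
    rw [sub_mul, mul_sub, smul_mul_assoc, mul_smul_comm]
    module
  rw [this, hr, hyy, Algebra.algebraMap_eq_smul_one]
  simp

/-- Frobenius' theorem for real algebras with a positive involution fixing only scalars. -/
theorem real_or_complex_or_quaternion [Nontrivial D] :
    Nonempty (D ≃ₐ[ℝ] ℝ) ∨ Nonempty (D ≃ₐ[ℝ] ℂ) ∨ Nonempty (D ≃ₐ[ℝ] Quaternion ℝ) := by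
  by_cases h0 : ∀ x : D, τ x = -x → x = 0
  · left
    refine ⟨(AlgEquiv.ofBijective (Algebra.ofId ℝ D) ⟨RingHom.injective _, fun a => ?_⟩).symm⟩
    obtain ⟨r, x, hx, rfl⟩ := h.exists_add_skew a
    exact ⟨r, by rw [h0 x hx, add_zero]; rfl⟩
  right
  push Not at h0
  obtain ⟨x, hx, hx0⟩ := h0
  obtain ⟨r, hii⟩ := h.exists_unit hx hx0
  have hi : τ (r • x) = -(r • x) := by rw [map_smul, hx, smul_neg]
  generalize r • x = i at hii hi
  clear hx hx0 r x
  by_cases h1 : ∀ y : D, τ y = -y → y * i + i * y = 0 → y = 0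
  · left
    refine ⟨(AlgEquiv.ofBijective (Complex.lift ⟨i, hii⟩) ⟨RingHom.injective _, fun a => ?_⟩).symm⟩
    obtain ⟨r, x, hx, rfl⟩ := h.exists_add_skew a
    obtain ⟨s, hs⟩ := h.exists_orthogonal hx hi hii
    have := h1 _ (by rw [map_sub, map_smul, hx, hi]; simp; abel) hs
    refine ⟨⟨r, s⟩, ?_⟩
    change Complex.liftAux i hii _ = _
    rw [Complex.liftAux_apply, sub_eq_zero.1 this]
  right
  push Not at h1
  obtain ⟨y, hy, hyi, hy0⟩ := h1
  obtain ⟨r, hjj⟩ := h.exists_unit hy hy0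
  have hj : τ (r • y) = -(r • y) := by rw [map_smul, hy, smul_neg]
  have hji : r • y * i = -(i * (r • y)) := by
    rw [smul_mul_assoc, mul_smul_comm, ← smul_neg, eq_neg_of_add_eq_zero_left hyi]
  generalize r • y = j at hjj hj hji
  clear hy hyi hy0 r y
  let q : QuaternionAlgebra.Basis D (-1 : ℝ) 0 (-1) :=
    { i := i, j := j, k := i * j, i_mul_i := by simp [hii], j_mul_j := by simp [hjj],
      i_mul_j := rfl, j_mul_i := by simp [hji] }
  let φ : Quaternion ℝ →ₐ[ℝ] D := q.liftHom
  refine ⟨(AlgEquiv.ofBijective φ ⟨RingHom.injective φ.toRingHom, fun a => ?_⟩).symm⟩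
  have hk : τ (i * j) = -(i * j) := by rw [h.map_mul, hi, hj, neg_mul_neg, hji]
  have hkk : (i * j) * (i * j) = -1 := by
    rw [mul_assoc, ← mul_assoc j, hji, neg_mul, mul_neg, mul_assoc, hjj, ← mul_assoc, mul_neg,
      mul_one, neg_neg, hii]
  have hki : (i * j) * i = -(i * (i * j)) := by rw [mul_assoc, hji, mul_neg]
  have hkj : j * (i * j) = -((i * j) * j) := by rw [← mul_assoc, hji, neg_mul]
  obtain ⟨r, x, hx, rfl⟩ := h.exists_add_skew a
  obtain ⟨s, hs⟩ := h.exists_orthogonal hx hi hii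
  have hx' : τ (x - s • i) = -(x - s • i) := by rw [map_sub, map_smul, hx, hi]; simp; abel
  obtain ⟨t, ht⟩ := h.exists_orthogonal hx' hj hjj
  have hx'' : τ (x - s • i - t • j) = -(x - s • i - t • j) := by
    rw [map_sub, map_smul, hx', hj]; simp; abel
  obtain ⟨u, hu⟩ := h.exists_orthogonal hx'' hk hkk
  -- The remainder anticommutes with `i` and with `j`, hence commutes with `i j`; being orthogonal
  -- to `i j` it also anticommutes with it, so it vanishes.
  have e : x - s • i - t • j - u • (i * j) = 0 := by
    set y := x - s • i - t • j - u • (i * j) with hy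
    have yi : y * i = -(i * y) := by
      apply eq_neg_of_add_eq_zero_left
      have : y * i + i * y = ((x - s • i) * i + i * (x - s • i)) - t • (j * i + i * j)
          - u • (i * j * i + i * (i * j)) := by
        rw [hy]
        simp only [sub_mul, mul_sub, smul_mul_assoc, mul_smul_comm, smul_add]
        abel
      rw [this, hs, hji, hki]; simp
    have yj : y * j = -(j * y) := by
      apply eq_neg_of_add_eq_zero_left
      have : y * j + j * y = ((x - s • i - t • j) * j + j * (x - s • i - t • j))
          - u • (i * j * j + j * (i * j)) := by
        rw [hy]
        simp only [sub_mul, mul_sub, smul_mul_assoc, mul_smul_comm, smul_add]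
        abel
      rw [this, ht, hkj]; simp
    have yk : y * (i * j) = (i * j) * y := by
      rw [← mul_assoc, yi, neg_mul, mul_assoc, yj, mul_neg, neg_neg, mul_assoc]
    rw [← yk, ← two_nsmul] at hu
    have : (2 : ℝ) • (y * (i * j)) = 0 := by rw [← hu, two_smul, two_nsmul]
    exact eq_zero_of_mul_eq_zero_of_mul_self hkk ((smul_eq_zero.1 this).resolve_left two_ne_zero)
  refine ⟨⟨r, s, t, u⟩, ?_⟩
  change q.lift _ = _
  rw [QuaternionAlgebra.Basis.lift]
  have : x = s • i + t • j + u • (i * j) := by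
    rw [← sub_eq_zero, ← e]; abel
  rw [this]
  simp only [add_assoc]
  rfl

/-- The trace of a positive involution fixing only scalars is `1 - (dim D - 1)`. -/
theorem trace_eq [Nontrivial D] [FiniteDimensional ℝ D] :
    LinearMap.trace ℝ D τ = 2 - Module.finrank ℝ D := by
  have key : LinearMap.trace ℝ D (τ + (LinearMap.id : D →ₗ[ℝ] D)) = 2 := by
    -- `τ + id` has its image in the line `ℝ·1`, where it is multiplication by `2`.
    have hm : ∀ x, (τ + (LinearMap.id : D →ₗ[ℝ] D)) x ∈ Submodule.span ℝ {(1 : D)} := fun x => by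
      obtain ⟨r, hr⟩ := h.eq_scalar ((τ + (LinearMap.id : D →ₗ[ℝ] D)) x)
        (by simp [h.involutive, add_comm])
      rw [hr, Algebra.algebraMap_eq_smul_one]
      exact Submodule.smul_mem _ _ (Submodule.mem_span_singleton_self _)
    rw [← LinearMap.trace_restrict_eq_of_forall_mem _ _ hm]
    have : (τ + (LinearMap.id : D →ₗ[ℝ] D)).restrict (fun x _ => hm x) =
        (2 : ℝ) • (LinearMap.id : Submodule.span ℝ {(1 : D)} →ₗ[ℝ] _) := by
      ext ⟨x, hx⟩
      obtain ⟨c, rfl⟩ := Submodule.mem_span_singleton.1 hx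
      simp [h.map_one, LinearMap.restrict_apply, two_smul]
    rw [this, map_smul, LinearMap.trace_id, finrank_span_singleton one_ne_zero]
    simp
  rw [map_add, LinearMap.trace_id] at key
  linarith

end IsScalarInvolution

end Frobenius

/-! ### Invariant inner products and the real trace formula -/

section Adjoint

open scoped MatrixOrder

/-- The coefficient of the matrix unit `E_ij` in `M E_ji N` is `M_ij N_ij`. -/
theorem Matrix.trace_mul_transpose_mul {n : Type*} [Fintype n] [DecidableEq n]
    (f : Matrix n n ℝ →ₗ[ℝ] Matrix n n ℝ) (M N : Matrix n n ℝ)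
    (hf : ∀ X, f X = M * X.transpose * N) :
    LinearMap.trace ℝ _ f = (M * N.transpose).trace := by
  rw [LinearMap.trace_eq_matrix_trace ℝ (Matrix.stdBasis ℝ n n), Matrix.trace, Matrix.trace,
    Fintype.sum_prod_type]
  refine Finset.sum_congr rfl fun i _ => ?_
  rw [Matrix.diag_apply, Matrix.mul_apply]
  refine Finset.sum_congr rfl fun j _ => ?_
  rw [Matrix.diag_apply, LinearMap.toMatrix_apply, Matrix.stdBasis_eq_single, hf,
    Matrix.transpose_single]
  change (M * Matrix.single j i (1 : ℝ) * N : Matrix n n ℝ) i j = _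
  rw [Matrix.mul_apply, Finset.sum_eq_single i]
  · simp [Matrix.transpose_apply]
  · intro k _ hk
    rw [Matrix.mul_single_apply_of_ne _ _ _ _ _ hk, zero_mul]
  · simp

variable {W : Type*} [AddCommGroup W] [Module ℝ W]

/-- `τ` has the formal properties of the adjoint with respect to a real inner product. -/
structure IsPositiveAdjoint (τ : Module.End ℝ W →ₗ[ℝ] Module.End ℝ W) : Prop where
  map_mul : ∀ X Y, τ (X * Y) = τ Y * τ X
  involutive : ∀ X, τ (τ X) = X
  trace_mul : ∀ M, LinearMap.trace ℝ (Module.End ℝ W)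
    (LinearMap.mulLeft ℝ M ∘ₗ LinearMap.mulRight ℝ (τ M) ∘ₗ τ) = LinearMap.trace ℝ W (M * M)
  trace_pos : ∀ X, X ≠ 0 → 0 < LinearMap.trace ℝ W (X * τ X)
  exists_eigenvalue : ∀ X, τ X = X → ∃ r : ℝ, Module.End.HasEigenvalue X r

/-- In orthonormal coordinates the adjoint is the transpose: positivity is that of the Frobenius
norm, and the eigenvalue comes from the spectral theorem for symmetric matrices. -/
theorem isPositiveAdjoint_of_matrix [FiniteDimensional ℝ W] {n : Type*} [Fintype n] [DecidableEq n]
    [Nonempty n] (Φ : Module.End ℝ W ≃ₐ[ℝ] Matrix n n ℝ)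
    (hΦ : ∀ X, (Φ X).trace = LinearMap.trace ℝ W X) :
    IsPositiveAdjoint (Φ.symm.toLinearMap ∘ₗ
      (Matrix.transposeLinearEquiv n n ℝ ℝ).toLinearMap ∘ₗ Φ.toLinearMap) where
  map_mul X Y := by simp [Matrix.transpose_mul]
  involutive X := by simp
  trace_mul M := by
    rw [← LinearMap.trace_conj' _ Φ.toLinearEquiv, ← hΦ,
      Matrix.trace_mul_transpose_mul _ (Φ M) (Φ M).transpose]
    · simp
    · intro X
      simp [LinearEquiv.conj_apply, mul_assoc]
  trace_pos X hX := by
    rw [← hΦ]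
    have h0 : Φ X ≠ 0 := by simpa using hX
    have h1 := (Matrix.posSemidef_self_mul_conjTranspose (Φ X)).trace_nonneg
    have h2 := Matrix.trace_mul_conjTranspose_self_eq_zero_iff (A := Φ X)
    simp only [Matrix.conjTranspose_eq_transpose_of_trivial] at h1 h2
    simpa using lt_of_le_of_ne h1 (fun h => h0 (h2.1 h.symm))
  exists_eigenvalue X hX := by
    have hs : (Φ X).IsHermitian := by
      have := congrArg Φ hX
      rw [Matrix.IsHermitian, Matrix.conjTranspose_eq_transpose_of_trivial]
      simpa using this
    obtain ⟨i⟩ := ‹Nonempty n›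
    refine ⟨hs.eigenvalues i, ?_⟩
    rw [Module.End.hasEigenvalue_iff_mem_spectrum, ← AlgEquiv.spectrum_eq Φ]
    exact hs.eigenvalues_mem_spectrum_real i

/-- A finite family of operators that is closed under composition up to sign is orthogonal for some
inner product. -/
theorem exists_isPositiveAdjoint [FiniteDimensional ℝ W] [Nontrivial W] {ι : Type*} [Fintype ι]
    (γ : ι → Module.End ℝ W) (k₀ : ι) (h1 : γ k₀ = 1)
    (hγ : ∀ k, ∃ σ : Equiv.Perm ι, ∀ l, γ (σ l) = γ l * γ k ∨ γ (σ l) = -(γ l * γ k)) :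
    ∃ τ : Module.End ℝ W →ₗ[ℝ] Module.End ℝ W, IsPositiveAdjoint τ ∧ ∀ k, τ (γ k) * γ k = 1 := by
  classical
  let b := Module.finBasis ℝ W
  have : Nonempty (Fin (Module.finrank ℝ W)) := ⟨⟨0, Module.finrank_pos⟩⟩
  let Ψ := algEquivMatrix b
  have hΨ : ∀ X, (Ψ X).trace = LinearMap.trace ℝ W X := fun X =>
    (LinearMap.trace_eq_matrix_trace ℝ b X).symm
  -- The Gram matrix of the averaged inner product. Right multiplication by `γ k` permutes the
  -- family up to sign, and the signs cancel in each summand.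
  let B := ∑ k, (Ψ (γ k)).transpose * Ψ (γ k)
  have hB : ∀ k, (Ψ (γ k)).transpose * B * Ψ (γ k) = B := fun k => by
    obtain ⟨σ, hσ⟩ := hγ k
    rw [Finset.mul_sum, Finset.sum_mul]
    refine Eq.trans (Finset.sum_congr rfl fun l _ => ?_)
      (Equiv.sum_comp σ fun k => (Ψ (γ k)).transpose * Ψ (γ k))
    rcases hσ l with h | h <;> rw [h] <;> simp [Matrix.transpose_mul, mul_assoc]
  have hBp : B.PosDef := by
    have e : B = 1 + ∑ k ∈ Finset.univ.erase k₀, (Ψ (γ k)).transpose * Ψ (γ k) := by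
      change ∑ k, (Ψ (γ k)).transpose * Ψ (γ k) = _
      rw [← Finset.add_sum_erase _ _ (Finset.mem_univ k₀), h1]
      simp
    rw [e]
    refine Matrix.PosDef.one.add_posSemidef (Matrix.posSemidef_sum _ fun k _ => ?_)
    simpa using Matrix.posSemidef_conjTranspose_mul_self (Ψ (γ k))
  -- Writing `B = Cᵀ C`, conjugation by `C` passes to coordinates orthonormal for `B`.
  obtain ⟨C, hC⟩ := CStarAlgebra.nonneg_iff_eq_star_mul_self.mp hBp.posSemidef.nonneg
  rw [Matrix.star_eq_conjTranspose, Matrix.conjTranspose_eq_transpose_of_trivial] at hC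
  have hCu : IsUnit C := isUnit_of_mul_isUnit_right (hC ▸ hBp.isUnit)
  obtain ⟨u, rfl⟩ := hCu
  let c := MulSemiringAction.toAlgEquiv ℝ
    (Matrix (Fin (Module.finrank ℝ W)) (Fin (Module.finrank ℝ W)) ℝ) (ConjAct.toConjAct u)
  let Φ := Ψ.trans c
  have hΦ : ∀ X, Φ X = u.val * Ψ X * u⁻¹.val := fun X => rfl
  refine ⟨_, isPositiveAdjoint_of_matrix Φ fun X => ?_, fun k => ?_⟩
  · rw [hΦ, Matrix.trace_units_conj, hΨ]
  · apply Φ.injective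
    simp only [LinearMap.comp_apply, map_mul]
    simp only [AlgEquiv.toLinearMap_apply, AlgEquiv.apply_symm_apply, LinearEquiv.coe_coe,
      Matrix.transposeLinearEquiv_apply, map_one]
    have h2 : u⁻¹.val.transpose * u.val.transpose = 1 := by
      rw [← Matrix.transpose_mul, Units.mul_inv, Matrix.transpose_one]
    rw [hΦ]
    change (u.val * Ψ (γ k) * u⁻¹.val).transpose * _ = _
    simp only [Matrix.transpose_mul]
    have h3 : u.val * u⁻¹.val = 1 := Units.mul_inv u
    calc _ = u⁻¹.val.transpose * ((Ψ (γ k)).transpose *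
          (u.val.transpose * u.val) * Ψ (γ k)) * u⁻¹.val := by
            simp only [mul_assoc]
      _ = _ := by
        rw [← hC, hB, hC, ← mul_assoc, h2, one_mul, h3]

namespace IsPositiveAdjoint

variable {τ : Module.End ℝ W →ₗ[ℝ] Module.End ℝ W} (h : IsPositiveAdjoint τ)
include h

/-- If `r` is an eigenvalue of a self-adjoint `X ∈ D`, then `X - r` lies in `D` and is not
injective, so it is zero. -/
theorem isScalarInvolution_restrict [FiniteDimensional ℝ W] [Nontrivial W]
    (D : Subalgebra ℝ (Module.End ℝ W))
    (hD : ∀ X ∈ D, X ≠ 0 → Function.Injective X)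
    (hτ : ∀ X ∈ Subalgebra.toSubmodule D, τ X ∈ Subalgebra.toSubmodule D) :
    IsScalarInvolution (D := D) (τ.restrict hτ) := by
  have scal : ∀ X ∈ D, τ X = X → ∃ r : ℝ, X = algebraMap ℝ _ r := fun X hX e => by
    obtain ⟨r, hr⟩ := h.exists_eigenvalue X e
    obtain ⟨v, hv⟩ := hr.exists_hasEigenvector
    refine ⟨r, ?_⟩
    by_contra hne
    have := hD (X - algebraMap ℝ _ r) (D.sub_mem hX (D.algebraMap_mem r)) (sub_ne_zero.2 hne)
    refine hv.2 (this ?_)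
    rw [LinearMap.sub_apply, hv.apply_eq_smul, Module.algebraMap_end_apply, sub_self, map_zero]
  refine ⟨fun a b => Subtype.ext (h.map_mul _ _), fun a => Subtype.ext (h.involutive _),
    fun a ha => ?_, fun a ha => ?_⟩
  · obtain ⟨r, hr⟩ := scal a a.2 (congrArg Subtype.val ha)
    exact ⟨r, Subtype.ext hr⟩
  · obtain ⟨r, hr⟩ := scal (a * τ a) (D.mul_mem a.2 (hτ _ a.2))
      (by rw [h.map_mul, h.involutive])
    refine ⟨r, ?_, Subtype.ext hr⟩
    -- The scalar `a τ(a) = r` has trace `r dim W`, so positivity of the trace gives `r > 0`.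
    have hp := h.trace_pos a (by simpa using ha)
    rw [hr, Algebra.algebraMap_eq_smul_one, map_smul, LinearMap.trace_one, smul_eq_mul] at hp
    exact pos_of_mul_pos_left hp (Nat.cast_nonneg _)

/-- The Frobenius-Schur trace formula over `ℝ`. -/
theorem sum_trace_mul_self [FiniteDimensional ℝ W] [Nontrivial W] {ι : Type*} [Fintype ι]
    [Nonempty ι] (γ : ι → Module.End ℝ W) (hγ : ∀ k, τ (γ k) * γ k = 1)
    (D : Subalgebra ℝ (Module.End ℝ W))
    (hD : ∀ X ∈ D, X ≠ 0 → Function.Injective X)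
    (hτ : ∀ X ∈ Subalgebra.toSubmodule D, τ X ∈ Subalgebra.toSubmodule D)
    (hcomm : ∀ X ∈ D, ∀ k, γ k * X = X * γ k)
    (hsum : ∀ X, ∑ k, γ k * X * τ (γ k) ∈ D) :
    ∑ k, LinearMap.trace ℝ W (γ k * γ k) =
      Fintype.card ι * (2 - (Module.finrank ℝ D : ℝ)) := by
  have hs := h.isScalarInvolution_restrict D hD hτ
  have hγ' : ∀ k, γ k * τ (γ k) = 1 := fun k => mul_eq_one_comm.1 (hγ k)
  let P : Module.End ℝ (Module.End ℝ W) :=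
    ∑ k, LinearMap.mulLeft ℝ (γ k) ∘ₗ LinearMap.mulRight ℝ (τ (γ k)) ∘ₗ τ
  have hP : ∀ X, P X = ∑ k, γ k * τ X * τ (γ k) := fun X => by
    simp [P, LinearMap.sum_apply, mul_assoc]
  have hPD : ∀ X, P X ∈ Subalgebra.toSubmodule D := fun X => by rw [hP]; exact hsum _
  -- On `D` each `γ k` commutes with `τ X` and cancels against `τ (γ k)`, so every summand is `τ X`.
  have e : P.restrict (fun X (_ : X ∈ Subalgebra.toSubmodule D) => hPD X) =
      (Fintype.card ι : ℝ) • τ.restrict hτ := by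
    ext1 X
    apply Subtype.ext
    change P X = (Fintype.card ι : ℝ) • τ X
    rw [hP, Finset.sum_congr rfl fun k _ => by rw [hcomm _ (hτ _ X.2), mul_assoc, hγ', mul_one],
      Finset.sum_const, Finset.card_univ, Nat.cast_smul_eq_nsmul]
  have ht := LinearMap.trace_restrict_eq_of_forall_mem (Subalgebra.toSubmodule D) P hPD
  rw [e, map_smul] at ht
  rw [Finset.sum_congr rfl fun k _ => (h.trace_mul (γ k)).symm, ← map_sum]
  change LinearMap.trace ℝ _ P = _
  rw [← ht, smul_eq_mul]
  congr 1
  exact hs.trace_eq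

end IsPositiveAdjoint

end Adjoint

/-! ### Schur's lemma over `ℂG` and the scalar of the commutator sum -/

section ComplexGroupAlgebra

variable {G : Type*} [Group G]
variable {U : Type*} [AddCommGroup U] [Module ℂ U] [Module (MonoidAlgebra ℂ G) U]
  [IsScalarTower ℂ (MonoidAlgebra ℂ G) U]

/-- The operator by which a group element acts on a `ℂG`-module. -/
noncomputable def groupAction (G : Type*) [Group G]
    (U : Type*) [AddCommGroup U] [Module ℂ U] [Module (MonoidAlgebra ℂ G) U]
    [IsScalarTower ℂ (MonoidAlgebra ℂ G) U] : G →* Module.End ℂ U :=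
  ((Algebra.lsmul ℂ ℂ U : MonoidAlgebra ℂ G →ₐ[ℂ] Module.End ℂ U) : _ →* _).comp
    (MonoidAlgebra.of ℂ G)

theorem groupAction_apply (g : G) (u : U) :
    groupAction G U g u = MonoidAlgebra.of ℂ G g • u := rfl

theorem moduleCharacter_eq (g : G) :
    moduleCharacter G U g = LinearMap.trace ℂ U (groupAction G U g) := rfl

/-- Operators commuting with the group are `ℂG`-linear. -/
noncomputable def linearOfCommute (X : Module.End ℂ U)
    (hX : ∀ g, groupAction G U g * X = X * groupAction G U g) :
    Module.End (MonoidAlgebra ℂ G) U where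
  toFun := X
  map_add' := map_add X
  map_smul' a u := by
    induction a using MonoidAlgebra.induction_on with
    | of g => exact (LinearMap.congr_fun (hX g) u).symm
    | add a b ha hb => simp only [RingHom.id_apply, add_smul, map_add] at *; rw [ha, hb]
    | smul r a ha => simp only [RingHom.id_apply, smul_assoc, map_smul] at *; rw [ha]

theorem IsSimpleModule.finiteDimensional_complex [Finite G]
    [IsSimpleModule (MonoidAlgebra ℂ G) U] : FiniteDimensional ℂ U := by
  have : Module.Finite ℂ (MonoidAlgebra ℂ G) := inferInstance
  exact Module.Finite.trans (MonoidAlgebra ℂ G) U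

theorem exists_eq_smul_one_of_commute [Finite G] [IsSimpleModule (MonoidAlgebra ℂ G) U]
    (X : Module.End ℂ U) (hX : ∀ g, groupAction G U g * X = X * groupAction G U g) :
    ∃ c : ℂ, X = c • 1 := by
  have := IsSimpleModule.finiteDimensional_complex (G := G) (U := U)
  obtain ⟨c, hc⟩ := (IsSimpleModule.algebraMap_end_bijective_of_isAlgClosed
    (A := MonoidAlgebra ℂ G) (V := U) ℂ).2 (linearOfCommute X hX)
  exact ⟨c, LinearMap.ext fun u => (LinearMap.congr_fun hc u).symm⟩

/-- The average commutes with `G`, so it is a scalar by Schur's lemma; taking traces identifies it.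
-/
theorem sum_groupAction_conj [Fintype G] [IsSimpleModule (MonoidAlgebra ℂ G) U]
    (X : Module.End ℂ U) :
    ∑ g : G, groupAction G U g * X * groupAction G U g⁻¹ =
      ((Fintype.card G : ℂ) * LinearMap.trace ℂ U X / Module.finrank ℂ U) • 1 := by
  have := IsSimpleModule.finiteDimensional_complex (G := G) (U := U)
  have : Nontrivial U := IsSimpleModule.nontrivial (MonoidAlgebra ℂ G) U
  obtain ⟨c, hc⟩ := exists_eq_smul_one_of_commute (G := G)
    (∑ g : G, groupAction G U g * X * groupAction G U g⁻¹) fun h => by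
      rw [Finset.mul_sum, Finset.sum_mul, ← Equiv.sum_comp (Equiv.mulLeft h)
        fun g => groupAction G U g * X * groupAction G U g⁻¹ * groupAction G U h]
      refine Finset.sum_congr rfl fun g _ => ?_
      simp only [Equiv.coe_mulLeft, mul_inv_rev, mul_assoc, ← map_mul]
      simp only [map_mul, mul_assoc, inv_mul_cancel, mul_one]
  have ht := congrArg (LinearMap.trace ℂ U) hc
  have hn : (Module.finrank ℂ U : ℂ) ≠ 0 := Nat.cast_ne_zero.2 Module.finrank_pos.ne'
  have hg : ∀ g : G, LinearMap.trace ℂ U (groupAction G U g * X * groupAction G U g⁻¹) =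
      LinearMap.trace ℂ U X := fun g => by
    rw [LinearMap.trace_mul_comm, ← mul_assoc, ← map_mul, inv_mul_cancel, map_one, one_mul]
  rw [map_sum, Finset.sum_congr rfl fun g _ => hg g, Finset.sum_const, Finset.card_univ, map_smul,
    LinearMap.trace_one, nsmul_eq_mul, smul_eq_mul] at ht
  rw [hc, ht, mul_div_cancel_right₀ _ hn]

theorem sum_character_smul_groupAction [Fintype G] [IsSimpleModule (MonoidAlgebra ℂ G) U] :
    ∑ g : G, LinearMap.trace ℂ U (groupAction G U g⁻¹) • groupAction G U g =
      ((Fintype.card G : ℂ) / Module.finrank ℂ U) • 1 := by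
  have := IsSimpleModule.finiteDimensional_complex (G := G) (U := U)
  let b := Module.finBasis ℂ U
  ext v
  have key : ∀ k, ∑ g : G, b.repr (groupAction G U g⁻¹ (b k)) k • groupAction G U g v =
      ((Fintype.card G : ℂ) / Module.finrank ℂ U) • (b.repr v k • b k) := fun k => by
    -- The averaging formula for the rank-one operator `x ↦ b_k^*(x) v`, evaluated at `b_k`; summing
    -- over `k` turns matrix coefficients into the character.
    have h := LinearMap.congr_fun
      (sum_groupAction_conj (G := G) ((b.coord k).smulRight v)) (b k)
    rw [LinearMap.sum_apply, LinearMap.trace_smulRight] at h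
    simp only [Module.End.mul_apply, LinearMap.smulRight_apply, map_smul, Module.Basis.coord_apply]
      at h
    rw [h, LinearMap.smul_apply, Module.End.one_apply, smul_smul]
    congr 1
    ring
  have ht : ∀ g : G, LinearMap.trace ℂ U (groupAction G U g⁻¹) =
      ∑ k, b.repr (groupAction G U g⁻¹ (b k)) k := fun g => by
    rw [LinearMap.trace_eq_matrix_trace ℂ b, Matrix.trace]
    simp [LinearMap.toMatrix_apply]
  simp only [LinearMap.sum_apply, LinearMap.smul_apply, ht, Finset.sum_smul]
  rw [Finset.sum_comm, Finset.sum_congr rfl fun k _ => key k, ← Finset.smul_sum, b.sum_repr,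
    Module.End.one_apply]

/-- The sum of all commutators of a finite group, in its real group algebra. -/
noncomputable def commutatorSum (G : Type*) [Group G] [Fintype G] : MonoidAlgebra ℝ G :=
  ∑ g : G, ∑ h : G, MonoidAlgebra.of ℝ G (g * (h * g⁻¹ * h⁻¹))

theorem realToComplex_of (g : G) :
    realToComplex G (MonoidAlgebra.of ℝ G g) = MonoidAlgebra.of ℂ G g := by
  simp [realToComplex]

/-- The sum over `h` of `h g⁻¹ h⁻¹` is the scalar `|G| χ(g⁻¹) / dim U`; the remaining sum over `g`
is the previous formula. Thus this element of `ℝG` detects the dimension of a simple module. -/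
theorem commutatorSum_smul [Fintype G] [IsSimpleModule (MonoidAlgebra ℂ G) U] (u : U) :
    realToComplex G (commutatorSum G) • u =
      ((Fintype.card G : ℂ) / Module.finrank ℂ U) ^ 2 • u := by
  have h1 : ∀ g : G, ∑ h : G, groupAction G U (g * (h * g⁻¹ * h⁻¹)) =
      ((Fintype.card G : ℂ) / Module.finrank ℂ U) •
        (LinearMap.trace ℂ U (groupAction G U g⁻¹) • groupAction G U g) := fun g => by
    simp only [map_mul, ← Finset.mul_sum]
    rw [sum_groupAction_conj, mul_smul_comm, mul_one, smul_smul]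
    congr 1
    ring
  have h2 : ∑ g : G, ∑ h : G, groupAction G U (g * (h * g⁻¹ * h⁻¹)) =
      ((Fintype.card G : ℂ) / Module.finrank ℂ U) ^ 2 • 1 := by
    rw [Finset.sum_congr rfl fun g _ => h1 g, ← Finset.smul_sum, sum_character_smul_groupAction,
      smul_smul, sq]
  have h3 := LinearMap.congr_fun h2 u
  simp only [LinearMap.sum_apply, groupAction_apply] at h3
  simp only [commutatorSum, map_sum, realToComplex_of, Finset.sum_smul]
  exact h3

end ComplexGroupAlgebra

/-! ### Central elements in a block of a semisimple ring -/

section CentralIdempotents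

variable {R : Type*} [Ring R] [IsSemisimpleRing R]

/-- By semisimplicity the ideal `(c)` is generated by an idempotent `u`, which is central because
`c` is. Primitivity leaves `u e = 0` or `u e = e`. -/
theorem IsPrimitiveCentralIdempotent.mul_eq_zero_or_exists {e : R}
    (he : IsPrimitiveCentralIdempotent e) {c : R} (hc : c ∈ Subring.center R) :
    c * e = 0 ∨ ∃ b, b * (c * e) = e := by
  obtain ⟨u, hu, hI⟩ := IsSemisimpleRing.ideal_eq_span_idempotent (Ideal.span {c})
  have hcy : ∀ y, y * c = c * y := Subring.mem_center_iff.1 hc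
  obtain ⟨b, hb⟩ := Ideal.mem_span_singleton'.1 (hI ▸ Ideal.mem_span_singleton_self u :
    u ∈ Ideal.span {c})
  obtain ⟨a, ha⟩ := Ideal.mem_span_singleton'.1 (hI ▸ Ideal.mem_span_singleton_self c :
    c ∈ Ideal.span {u})
  have huu : u * u = u := hu
  have hcu : c * u = c := by rw [← ha, mul_assoc, huu]
  have h1 : ∀ y, u * y * u = u * y := fun y => by
    have : u * y = b * y * c := by rw [← hb, mul_assoc, ← hcy, mul_assoc]
    rw [this, mul_assoc, hcu]
  -- The difference `t = y u - u y u` satisfies `u t = 0`, hence `c t = 0`, and also `t = t u = t b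
  -- c`; centrality of `c` then forces `t = 0`.
  have h2 : ∀ y, u * y * u = y * u := fun y => by
    have ht : u * (y * u - u * y * u) = 0 := by
      rw [mul_sub, ← mul_assoc, ← mul_assoc, ← mul_assoc, huu, sub_self]
    have hc0 : c * (y * u - u * y * u) = 0 := by rw [← ha, mul_assoc, ht, mul_zero]
    have htu : (y * u - u * y * u) * u = y * u - u * y * u := by
      rw [sub_mul, mul_assoc, mul_assoc _ u u, huu]
    have : y * u - u * y * u = 0 := by
      rw [← htu, ← hb, ← mul_assoc, hcy, ← mul_assoc, hb, hc0, zero_mul]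
    exact (sub_eq_zero.1 this).symm
  have huc : u ∈ Subring.center R := Subring.mem_center_iff.2 fun y => by rw [← h1, h2]
  obtain ⟨hee, hec, _, hp⟩ := he
  have hee' : e * e = e := hee
  rcases hp (u * e) (hu.mul_of_commute (Subring.mem_center_iff.1 hec u) hee)
    (Subring.mul_mem _ huc hec) (by rw [mul_assoc, hee']) with h | h
  · left; rw [← hcu, mul_assoc, h, mul_zero]
  · right; exact ⟨b, by rw [← mul_assoc, hb, h]⟩

end CentralIdempotents

/-! ### The commutant of an orthogonal family -/

section RealFrobeniusSchur

variable {W : Type*} [AddCommGroup W] [Module ℝ W]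

theorem IsPositiveAdjoint.mem_centralizer {τ : Module.End ℝ W →ₗ[ℝ] Module.End ℝ W}
    (h : IsPositiveAdjoint τ) {ι : Type*} {γ : ι → Module.End ℝ W}
    (hγ : ∀ k, τ (γ k) * γ k = 1) (hγ' : ∀ k, γ k * τ (γ k) = 1) {X : Module.End ℝ W}
    (hX : X ∈ Subalgebra.centralizer ℝ (Set.range γ)) :
    τ X ∈ Subalgebra.centralizer ℝ (Set.range γ) := by
  rw [Subalgebra.mem_centralizer_iff] at hX ⊢
  rintro _ ⟨k, rfl⟩
  have h1 := congrArg τ (hX _ ⟨k, rfl⟩)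
  rw [h.map_mul, h.map_mul] at h1
  calc γ k * τ X = γ k * (τ X * τ (γ k)) * γ k := by
        rw [mul_assoc, mul_assoc, hγ, mul_one]
    _ = τ X * γ k := by rw [h1, ← mul_assoc, hγ', one_mul]

theorem IsPositiveAdjoint.sum_mem_centralizer {τ : Module.End ℝ W →ₗ[ℝ] Module.End ℝ W}
    (h : IsPositiveAdjoint τ) {ι : Type*} [Fintype ι] {γ : ι → Module.End ℝ W}
    (hγ : ∀ k, τ (γ k) * γ k = 1)
    (hl : ∀ k, ∃ σ : Equiv.Perm ι, ∀ l, γ (σ l) = γ k * γ l ∨ γ (σ l) = -(γ k * γ l))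
    (X : Module.End ℝ W) :
    ∑ k, γ k * X * τ (γ k) ∈ Subalgebra.centralizer ℝ (Set.range γ) := by
  rw [Subalgebra.mem_centralizer_iff]
  rintro _ ⟨j, rfl⟩
  obtain ⟨σ, hσ⟩ := hl j
  rw [Finset.mul_sum, Finset.sum_mul, ← Equiv.sum_comp σ fun k => γ k * X * τ (γ k) * γ j]
  refine Finset.sum_congr rfl fun k _ => ?_
  have : γ (σ k) * X * τ (γ (σ k)) = γ j * γ k * X * τ (γ j * γ k) := by
    rcases hσ k with e | e <;> rw [e]
    rw [map_neg, neg_mul, neg_mul_neg]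
  rw [this, h.map_mul]
  simp only [mul_assoc, hγ, mul_one]

end RealFrobeniusSchur

/-! ### The skew group algebra, its commutants and the odd square sum -/

section Skew

variable {Gh : Type*} [Group Gh] (π : Gh →* ℤˣ)

/-- The element `a z` of `ℂ ∗ Ĝ`. -/
noncomputable def skewSingle (z : Gh) (a : ℂ) : SkewGroupAlgebra π :=
  SkewMonoidAlgebra.single ((Graded.toGroup π).symm z) a

variable {π}

theorem skewSingle_mul_of_even {y : Gh} (hy : π y = 1) (z : Gh) (a b : ℂ) :
    skewSingle π y a * skewSingle π z b = skewSingle π (y * z) (a * b) := by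
  rw [skewSingle, skewSingle, SkewMonoidAlgebra.single_mul_single, Graded.smul_def]
  simp [skewSingle, hy]

theorem skewSingle_mul_of_odd {y : Gh} (hy : π y = -1) (z : Gh) (a b : ℂ) :
    skewSingle π y a * skewSingle π z b = skewSingle π (y * z) (a * (starRingEnd ℂ) b) := by
  rw [skewSingle, skewSingle, SkewMonoidAlgebra.single_mul_single, Graded.smul_def]
  simp [skewSingle, hy]

theorem skewSingle_mul_one (y z : Gh) (a : ℂ) :
    skewSingle π y a * skewSingle π z 1 = skewSingle π (y * z) a := by
  rcases Int.units_eq_one_or (π y) with hy | hy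
  · rw [skewSingle_mul_of_even hy, mul_one]
  · rw [skewSingle_mul_of_odd hy, map_one, mul_one]

theorem skewSingle_one : skewSingle π 1 1 = 1 := by
  rw [skewSingle, map_one, SkewMonoidAlgebra.one_def]

theorem skewSingle_add (z : Gh) (a b : ℂ) :
    skewSingle π z (a + b) = skewSingle π z a + skewSingle π z b :=
  SkewMonoidAlgebra.single_add _ _ _

theorem skewSingle_neg (z : Gh) (a : ℂ) : skewSingle π z (-a) = -skewSingle π z a :=
  SkewMonoidAlgebra.single_neg _ _

theorem smul_skewSingle (r : ℝ) (z : Gh) (a : ℂ) :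
    r • skewSingle π z a = skewSingle π z (r * a) := by
  rw [skewSingle, SkewMonoidAlgebra.smul_single, Complex.real_smul, skewSingle]

theorem skew_induction {p : SkewGroupAlgebra π → Prop} (a : SkewGroupAlgebra π)
    (hs : ∀ z c, p (skewSingle π z c)) (ha : ∀ a b, p a → p b → p (a + b)) : p a := by
  refine SkewMonoidAlgebra.induction_on a ?_ (fun z c => hs z c) ha
  have := hs 1 0
  rwa [skewSingle, SkewMonoidAlgebra.single_zero_right] at this

theorem realToSkew_of (z : Gh) : realToSkew π (MonoidAlgebra.of ℝ Gh z) = skewSingle π z 1 := by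
  simp [realToSkew]
  rfl

theorem evenToSkew_of (g : π.ker) :
    realToSkew π (evenToReal π (MonoidAlgebra.of ℝ π.ker g)) = skewSingle π g 1 := by
  rw [← realToSkew_of]
  simp [evenToReal]

theorem conjReal_of (w : Gh) (g : π.ker) :
    conjReal π w (MonoidAlgebra.of ℝ π.ker g) =
      MonoidAlgebra.of ℝ π.ker (MulAut.conjNormal w g) := by
  simp [conjReal]

/-- Moving `w` past an element of `ℝG` conjugates it; the coefficient `a` passes through because the
elements of `ℝG` have real coefficients and even support. -/
theorem evenToSkew_conjReal_mul (w : Gh) (c : MonoidAlgebra ℝ π.ker) (a : ℂ) :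
    realToSkew π (evenToReal π (conjReal π w c)) * skewSingle π w a =
      skewSingle π w a * realToSkew π (evenToReal π c) := by
  induction c using MonoidAlgebra.induction_on with
  | of g =>
    have hg : π (MulAut.conjNormal w g : π.ker) = 1 := (MulAut.conjNormal w g : π.ker).2
    rw [conjReal_of, evenToSkew_of, evenToSkew_of, skewSingle_mul_of_even hg, skewSingle_mul_one,
      one_mul, MulAut.conjNormal_apply, inv_mul_cancel_right]
  | add x y hx hy => simp only [map_add, add_mul, mul_add, hx, hy]
  | smul r x hx => simp only [map_smul, smul_mul_assoc, mul_smul_comm, hx]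

theorem mem_center_of_conjReal_eq {c : MonoidAlgebra ℝ π.ker}
    (hc : ∀ w, conjReal π w c = c) : c ∈ Subring.center (MonoidAlgebra ℝ π.ker) := by
  have key : ∀ (g : π.ker) (x : MonoidAlgebra ℝ π.ker), conjReal π g x * MonoidAlgebra.of ℝ π.ker g =
      MonoidAlgebra.of ℝ π.ker g * x := fun g x => by
    induction x using MonoidAlgebra.induction_on with
    | of h =>
      rw [conjReal_of, ← map_mul, ← map_mul]
      congr 1
      ext
      simp
    | add x y hx hy => simp only [map_add, add_mul, mul_add, hx, hy]
    | smul r x hx => simp only [map_smul, smul_mul_assoc, mul_smul_comm, hx]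
  rw [Subring.mem_center_iff]
  intro y
  induction y using MonoidAlgebra.induction_on with
  | of g => rw [← key, hc]
  | add x y hx hy => rw [add_mul, mul_add, hx, hy]
  | smul r x hx => rw [smul_mul_assoc, mul_smul_comm, hx]

variable {W : Type*} [AddCommGroup W] [Module ℝ W] [Module (SkewGroupAlgebra π) W]
  [IsScalarTower ℝ (SkewGroupAlgebra π) W]

variable (π W) in
/-- The operator by which `a z` acts on a `ℂ ∗ Ĝ`-module. -/
noncomputable def skewAction (z : Gh) (a : ℂ) : Module.End ℝ W :=
  Algebra.lsmul ℝ ℝ W (skewSingle π z a)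

theorem skewAction_apply (z : Gh) (a : ℂ) (x : W) : skewAction π W z a x = skewSingle π z a • x :=
  rfl

variable (π W) in
/-- The operators of the elements `z` and `i z`, for `z ∈ Ĝ`. -/
noncomputable def skewFamily (k : Gh × Bool) : Module.End ℝ W :=
  skewAction π W k.1 (if k.2 then Complex.I else 1)

theorem skewAction_mul_of_even {y : Gh} (hy : π y = 1) (z : Gh) (a b : ℂ) :
    skewAction π W y a * skewAction π W z b = skewAction π W (y * z) (a * b) := by
  rw [skewAction, skewAction, ← map_mul, skewSingle_mul_of_even hy, skewAction]

theorem skewAction_mul_of_odd {y : Gh} (hy : π y = -1) (z : Gh) (a b : ℂ) :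
    skewAction π W y a * skewAction π W z b = skewAction π W (y * z) (a * (starRingEnd ℂ) b) := by
  rw [skewAction, skewAction, ← map_mul, skewSingle_mul_of_odd hy, skewAction]

theorem skewAction_neg (z : Gh) (a : ℂ) : skewAction π W z (-a) = -skewAction π W z a := by
  rw [skewAction, skewSingle_neg, map_neg, skewAction]

theorem skewAction_one : skewAction π W 1 1 = 1 := by
  rw [skewAction, skewSingle_one, map_one]

theorem skewFamily_mul (k l : Gh × Bool) :
    skewFamily π W (k.1 * l.1, xor k.2 l.2) = skewFamily π W k * skewFamily π W l ∨
    skewFamily π W (k.1 * l.1, xor k.2 l.2) = -(skewFamily π W k * skewFamily π W l) := by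
  obtain ⟨y, a⟩ := k
  obtain ⟨z, b⟩ := l
  simp only [skewFamily]
  rcases Int.units_eq_one_or (π y) with hy | hy
  · rw [skewAction_mul_of_even hy, ← skewAction_neg]
    cases a <;> cases b <;> simp
  · rw [skewAction_mul_of_odd hy, ← skewAction_neg]
    cases a <;> cases b <;> simp

/-- An operator commuting with all `z` and `i z` is `ℂ ∗ Ĝ`-linear. -/
theorem map_skew_smul {X : Module.End ℝ W}
    (hX : X ∈ Subalgebra.centralizer ℝ (Set.range (skewFamily π W)))
    (a : SkewGroupAlgebra π) (x : W) : X (a • x) = a • X x := by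
  rw [Subalgebra.mem_centralizer_iff] at hX
  induction a using skew_induction with
  | hs z c =>
    have e : skewSingle π z c = c.re • skewSingle π z 1 + c.im • skewSingle π z Complex.I := by
      rw [smul_skewSingle, smul_skewSingle, ← skewSingle_add, mul_one, Complex.re_add_im]
    have h1 := LinearMap.congr_fun (hX _ ⟨(z, false), rfl⟩) x
    have h2 := LinearMap.congr_fun (hX _ ⟨(z, true), rfl⟩) x
    simp only [skewFamily, Module.End.mul_apply, skewAction_apply, if_true, Bool.false_eq_true,
      if_false] at h1 h2
    rw [e, add_smul, add_smul, map_add, smul_assoc, smul_assoc, smul_assoc, smul_assoc,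
      X.map_smul, X.map_smul, h1, h2]
  | ha a b ha hb => rw [add_smul, add_smul, map_add, ha, hb]

variable (π W) in
/-- The algebra of `ℂ ∗ Ĝ`-endomorphisms as a commutant. -/
noncomputable def commutantEquiv :
    Subalgebra.centralizer ℝ (Set.range (skewFamily π W)) ≃ₐ[ℝ]
      Module.End (SkewGroupAlgebra π) W where
  toFun X := { toFun := X.1, map_add' := map_add X.1, map_smul' := map_skew_smul X.2 }
  invFun f := ⟨f.restrictScalars ℝ, by
    rw [Subalgebra.mem_centralizer_iff]
    rintro _ ⟨k, rfl⟩
    ext x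
    exact (map_smul f _ x).symm⟩
  left_inv _ := rfl
  right_inv _ := rfl
  map_mul' _ _ := rfl
  map_add' _ _ := rfl
  commutes' _ := rfl

theorem injective_of_mem_commutant [IsSimpleModule (SkewGroupAlgebra π) W] (X : Module.End ℝ W)
    (hX : X ∈ Subalgebra.centralizer ℝ (Set.range (skewFamily π W))) (h0 : X ≠ 0) :
    Function.Injective X := by
  rcases LinearMap.injective_or_eq_zero (commutantEquiv π W ⟨X, hX⟩) with h | h
  · exact h
  · exact absurd (LinearMap.ext fun x => (LinearMap.congr_fun h x : _) : X = 0) h0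

theorem finiteDimensional_of_isSimpleModule_skew [Finite Gh]
    [IsSimpleModule (SkewGroupAlgebra π) W] : FiniteDimensional ℝ W := by
  have : Finite (Graded π) := inferInstanceAs (Finite Gh)
  have : Module.Finite ℝ (SkewGroupAlgebra π) :=
    Module.Finite.equiv (SkewMonoidAlgebra.coeffLinearEquiv (S := ℝ) (k := ℂ) (G := Graded π)).symm
  exact Module.Finite.trans (SkewGroupAlgebra π) W

theorem evenToSkew_mem_commutant {c : MonoidAlgebra ℝ π.ker} (hc : ∀ w, conjReal π w c = c) :
    Algebra.lsmul ℝ ℝ W (realToSkew π (evenToReal π c)) ∈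
      Subalgebra.centralizer ℝ (Set.range (skewFamily π W)) := by
  rw [Subalgebra.mem_centralizer_iff]
  rintro _ ⟨k, rfl⟩
  rw [skewFamily, skewAction, ← map_mul, ← evenToSkew_conjReal_mul, hc, map_mul]

variable [Fintype Gh]

variable (π) in
/-- The sum of the squares of the odd elements, in the real group algebra of `G`. -/
noncomputable def oddSquareSum : MonoidAlgebra ℝ π.ker :=
  ∑ z : Gh with π z = -1, MonoidAlgebra.of ℝ π.ker (sqEven π z)

theorem conjReal_oddSquareSum (w : Gh) : conjReal π w (oddSquareSum π) = oddSquareSum π := by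
  rw [oddSquareSum, map_sum]
  refine Finset.sum_equiv (MulAut.conj w).toEquiv (fun z => ?_) fun z _ => ?_
  · have : π (MulAut.conj w z) = π z := by
      rw [MulAut.conj_apply, map_mul, map_mul, map_inv, mul_right_comm, mul_inv_cancel, one_mul]
    simp only [Finset.mem_filter, Finset.mem_univ, true_and]
    exact (Eq.congr_left this).symm
  · rw [conjReal_of]
    congr 1
    ext
    simp [sqEven]

theorem evenToSkew_oddSquareSum :
    Algebra.lsmul ℝ ℝ W (realToSkew π (evenToReal π (oddSquareSum π))) =
      ∑ z : Gh with π z = -1, skewAction π W (z ^ 2) 1 := by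
  simp only [oddSquareSum, map_sum]
  exact Finset.sum_congr rfl fun z _ => by rw [evenToSkew_of]; rfl

/-- For even `z` the squares of `z` and `i z` are opposite; for odd `z` they agree, since `z`
conjugates `i`. -/
theorem sum_skewFamily_mul_self :
    ∑ k, skewFamily π W k * skewFamily π W k =
      (2 : ℝ) • ∑ z : Gh with π z = -1, skewAction π W (z ^ 2) 1 := by
  rw [Fintype.sum_prod_type, Finset.smul_sum, Finset.sum_filter]
  refine Finset.sum_congr rfl fun z _ => ?_
  rw [Fintype.sum_bool]
  simp only [skewFamily, if_true, Bool.false_eq_true, if_false]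
  rcases Int.units_eq_one_or (π z) with hz | hz
  · rw [skewAction_mul_of_even hz, skewAction_mul_of_even hz, Complex.I_mul_I, skewAction_neg,
      mul_one, neg_add_cancel, if_neg (by rw [hz]; decide)]
  · rw [skewAction_mul_of_odd hz, skewAction_mul_of_odd hz, if_pos hz, map_one, Complex.conj_I,
      mul_neg, Complex.I_mul_I, neg_neg, mul_one, two_smul, sq]

/-- The endomorphism algebra of a simple `ℂ ∗ Ĝ`-module is `ℝ`, `ℂ` or `ℍ`, and its dimension is
determined by the scalar by which the sum of the squares of the odd elements acts. -/
theorem skew_frobeniusSchur [IsSimpleModule (SkewGroupAlgebra π) W] :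
    (IsOfType π W ℝ ∨ IsOfType π W ℂ ∨ IsOfType π W (Quaternion ℝ)) ∧
    ∃ r : ℝ, (∀ x : W, realToSkew π (evenToReal π (oddSquareSum π)) • x = r • x) ∧
      r * Module.finrank ℝ W =
        Fintype.card Gh * (2 - (Module.finrank ℝ (Module.End (SkewGroupAlgebra π) W) : ℝ)) := by
  have := finiteDimensional_of_isSimpleModule_skew (π := π) (W := W)
  have : Nontrivial W := IsSimpleModule.nontrivial (SkewGroupAlgebra π) W
  have h1 : skewFamily π W (1, false) = 1 := skewAction_one
  obtain ⟨τ, h, hγ⟩ := exists_isPositiveAdjoint (skewFamily π W) (1, false) h1 fun k =>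
    ⟨(Equiv.mulRight k.1).prodCongr ⟨fun b => xor b k.2, fun b => xor b k.2, fun b => by simp,
      fun b => by simp⟩, fun l => skewFamily_mul l k⟩
  have hγ' : ∀ k, skewFamily π W k * τ (skewFamily π W k) = 1 := fun k => mul_eq_one_comm.1 (hγ k)
  have hτ := fun X hX => h.mem_centralizer (X := X) hγ hγ' hX
  have hs := h.isScalarInvolution_restrict _ injective_of_mem_commutant hτ
  have hsum := h.sum_mem_centralizer hγ fun k =>
    ⟨(Equiv.mulLeft k.1).prodCongr ⟨fun b => xor k.2 b, fun b => xor k.2 b, fun b => by simp,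
      fun b => by simp⟩, fun l => skewFamily_mul k l⟩
  have htr := h.sum_trace_mul_self _ hγ _ injective_of_mem_commutant hτ
    (fun X hX k => Subalgebra.mem_centralizer_iff ℝ |>.1 hX _ ⟨k, rfl⟩) hsum
  refine ⟨?_, ?_⟩
  · have e := (commutantEquiv π W).symm
    rcases hs.real_or_complex_or_quaternion with f | f | f
    · exact Or.inl (f.map e.trans)
    · exact Or.inr (Or.inl (f.map e.trans))
    · exact Or.inr (Or.inr (f.map e.trans))
  -- The adjoint of the operator of `z²` is that of `z⁻²`, and inversion permutes the odd elements.
  have hsq : τ (∑ z : Gh with π z = -1, skewAction π W (z ^ 2) 1) =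
      ∑ z : Gh with π z = -1, skewAction π W (z ^ 2) 1 := by
    rw [map_sum]
    refine Finset.sum_equiv (Equiv.inv Gh) (fun z => by simp) fun z hz => ?_
    have e1 : skewAction π W (z ^ 2) 1 * skewAction π W ((Equiv.inv Gh z) ^ 2) 1 = 1 := by
      rw [skewAction_mul_of_even (by rw [map_pow, Int.units_sq]), Equiv.inv_apply, inv_pow,
        mul_inv_cancel, mul_one, skewAction_one]
    have e2 : τ (skewAction π W (z ^ 2) 1) * skewAction π W (z ^ 2) 1 = 1 := hγ (z ^ 2, false)
    exact left_inv_eq_right_inv e2 e1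
  have hmem := evenToSkew_mem_commutant (W := W) (conjReal_oddSquareSum (π := π))
  obtain ⟨r, hr⟩ := hs.eq_scalar ⟨_, hmem⟩
    (Subtype.ext (by
      change τ (Algebra.lsmul ℝ ℝ W _) = Algebra.lsmul ℝ ℝ W _
      rw [evenToSkew_oddSquareSum, hsq]))
  have hr' : Algebra.lsmul ℝ ℝ W (realToSkew π (evenToReal π (oddSquareSum π))) = r • 1 :=
    (congrArg Subtype.val hr).trans (Algebra.algebraMap_eq_smul_one r)
  refine ⟨r, fun x => LinearMap.congr_fun hr' x, ?_⟩
  rw [← map_sum, sum_skewFamily_mul_self, ← evenToSkew_oddSquareSum, hr', map_smul, map_smul,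
    LinearMap.trace_one, (commutantEquiv π W).toLinearEquiv.finrank_eq, Fintype.card_prod,
    Fintype.card_bool] at htr
  simp only [smul_eq_mul] at htr
  push_cast at htr
  linarith

end Skew

/-! ### Transfer of scalars within an A-block -/

section Transfer

theorem evenToSkew_conjReal_smul_eq_zero {Gh : Type*} [Group Gh] {π : Gh →* ℤˣ}
    {W : Type*} [AddCommGroup W] [Module (SkewGroupAlgebra π) W] {e : MonoidAlgebra ℝ π.ker}
    (he : ∀ x : W, realToSkew π (evenToReal π e) • x = 0) (w : Gh) (x : W) :
    realToSkew π (evenToReal π (conjReal π w e)) • x = 0 := by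
  have hx : skewSingle π w 1 • skewSingle π w⁻¹ 1 • x = x := by
    rw [← mul_smul, skewSingle_mul_one, mul_inv_cancel, skewSingle_one, one_smul]
  rw [← hx, ← mul_smul, evenToSkew_conjReal_mul, mul_smul, he, smul_zero]

variable {Gh : Type*} [Group Gh] {π : Gh →* ℤˣ}
  {V : Type*} [AddCommGroup V] [Module ℂ V] [Module (MonoidAlgebra ℂ π.ker) V]
  [IsScalarTower ℂ (MonoidAlgebra ℂ π.ker) V]
  {W : Type*} [AddCommGroup W] [Module ℝ W] [Module (SkewGroupAlgebra π) W]
  [IsScalarTower ℝ (SkewGroupAlgebra π) W]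

/-- A conjugation invariant element of `ℝG` acts by the same real scalar on modules in the same
A-block. -/
theorem InSameABlock.smul_eq [Finite Gh] [Nontrivial W] (h : InSameABlock π V W)
    {c : MonoidAlgebra ℝ π.ker} (hc : ∀ w, conjReal π w c = c) {r : ℝ}
    (hW : ∀ x : W, realToSkew π (evenToReal π c) • x = r • x) (v : V) :
    realToComplex π.ker c • v = (r : ℂ) • v := by
  obtain ⟨e, w, he, -, hV, hW'⟩ := h
  have hc' : ∀ w, conjReal π w (c - algebraMap ℝ _ r) = c - algebraMap ℝ _ r := fun w => by
    rw [map_sub, hc, AlgEquiv.commutes]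
  have hW0 : ∀ x : W, realToSkew π (evenToReal π (c - algebraMap ℝ _ r)) • x = 0 := fun x => by
    rw [map_sub, map_sub, AlgHom.commutes, AlgHom.commutes, sub_smul, hW, algebraMap_smul, sub_self]
  -- Either `c - r` kills the `e`-block, hence also its conjugate and `V`; or it is invertible
  -- there, and then `e`, its conjugate and so the block idempotent would kill `W`.
  rcases he.mul_eq_zero_or_exists (mem_center_of_conjReal_eq hc') with h0 | ⟨b, hb⟩
  · have h1 : (c - algebraMap ℝ _ r) * conjReal π w e = 0 := by
      have := congrArg (conjReal π w) h0
      rwa [map_mul, hc', map_zero] at this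
    have h2 : (c - algebraMap ℝ _ r) * blockIdempotent π w e = 0 := by
      rw [blockIdempotent]
      split_ifs
      · exact h0
      · rw [mul_add, h0, h1, add_zero]
    have h3 := congrArg (realToComplex π.ker) h2
    rw [map_mul, map_zero] at h3
    have h4 : realToComplex π.ker (c - algebraMap ℝ _ r) • v = 0 := by
      rw [← hV v, ← mul_smul, h3, zero_smul]
    rw [map_sub, AlgHom.commutes, sub_smul, sub_eq_zero] at h4
    rw [h4, IsScalarTower.algebraMap_apply ℝ ℂ, algebraMap_smul]
    rfl
  · exfalso
    have he0 : ∀ x : W, realToSkew π (evenToReal π e) • x = 0 := fun x => by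
      have hcomm := Subring.mem_center_iff.1 (mem_center_of_conjReal_eq hc') e
      rw [← hb, ← hcomm, ← mul_assoc, map_mul, map_mul, mul_smul, hW0, smul_zero]
    obtain ⟨x, hx⟩ := exists_ne (0 : W)
    apply hx
    rw [← hW' x, blockIdempotent]
    split_ifs
    · exact he0 x
    · rw [map_add, map_add, add_smul, he0, evenToSkew_conjReal_smul_eq_zero he0, add_zero]

/-- The operator of `c - r` lies in the commutant of a simple module, so it is zero as soon as it
has a kernel. -/
theorem smul_eq_of_exists_smul_eq [IsSimpleModule (SkewGroupAlgebra π) W]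
    {c : MonoidAlgebra ℝ π.ker} (hc : ∀ w, conjReal π w c = c) {r : ℝ} {u : W} (hu : u ≠ 0)
    (h : realToSkew π (evenToReal π c) • u = r • u) (x : W) :
    realToSkew π (evenToReal π c) • x = r • x := by
  have hm := Subalgebra.sub_mem _ (evenToSkew_mem_commutant (W := W) hc)
    (Subalgebra.algebraMap_mem (Subalgebra.centralizer ℝ (Set.range (skewFamily π W))) r)
  by_contra hx
  refine hu (injective_of_mem_commutant _ hm (fun h0 => hx ?_) ?_)
  · exact sub_eq_zero.1 (LinearMap.congr_fun h0 x)
  · rw [map_zero]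
    exact sub_eq_zero.2 h

theorem conjReal_commutatorSum [Fintype π.ker] (w : Gh) :
    conjReal π w (commutatorSum π.ker) = commutatorSum π.ker := by
  simp only [commutatorSum, map_sum, conjReal_of]
  refine Fintype.sum_equiv (MulAut.conjNormal w : MulAut π.ker).toEquiv _ _ fun g => ?_
  refine Fintype.sum_equiv (MulAut.conjNormal w : MulAut π.ker).toEquiv _ _ fun h => ?_
  simp

end Transfer

theorem Quaternion.exists_mul_ne : ∃ a b : Quaternion ℝ, a * b ≠ b * a := by
  change ∃ a b : QuaternionAlgebra ℝ (-1) 0 (-1), a * b ≠ b * a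
  refine ⟨⟨0, 1, 0, 0⟩, ⟨0, 0, 1, 0⟩, fun h => ?_⟩
  have h2 := congrArg QuaternionAlgebra.imK h
  rw [QuaternionAlgebra.imK_mul, QuaternionAlgebra.imK_mul] at h2
  norm_num at h2

/-! ### Restriction of `W` to `ℂG` -/

section ComplexStructure

variable {Gh : Type*} [Group Gh] (π : Gh →* ℤˣ)

/-- The inclusion `ℂ → ℂ ∗ Ĝ`. -/
noncomputable def complexScalarToSkew : ℂ →+* SkewGroupAlgebra π where
  toFun := skewSingle π 1
  map_one' := skewSingle_one
  map_mul' a b := by rw [skewSingle_mul_of_even (map_one π), one_mul]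
  map_zero' := SkewMonoidAlgebra.single_zero_right _
  map_add' := skewSingle_add 1

/-- The inclusion `ℂG → ℂ ∗ Ĝ`. -/
noncomputable def complexToSkew : MonoidAlgebra ℂ π.ker →+* SkewGroupAlgebra π :=
  MonoidAlgebra.liftNCRingHom (complexScalarToSkew π)
    { toFun := fun g => skewSingle π g 1
      map_one' := skewSingle_one
      map_mul' := fun g h => by rw [skewSingle_mul_one]; rfl }
    fun a g => by
      change skewSingle π 1 a * skewSingle π g 1 = skewSingle π g 1 * skewSingle π 1 a
      rw [skewSingle_mul_one, skewSingle_mul_of_even g.2, one_mul, mul_one, one_mul]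

theorem complexToSkew_single (g : π.ker) (a : ℂ) :
    complexToSkew π (MonoidAlgebra.single g a) = skewSingle π g a := by
  refine (MonoidAlgebra.liftNC_single _ _ _ _).trans ?_
  change skewSingle π 1 a * skewSingle π g 1 = _
  rw [skewSingle_mul_one, one_mul]

theorem complexToSkew_smul (a : ℂ) (x : MonoidAlgebra ℂ π.ker) :
    complexToSkew π (a • x) = complexScalarToSkew π a * complexToSkew π x := by
  have h1 : a • x = (a • 1) * x := by rw [smul_mul_assoc, one_mul]
  rw [h1, map_mul, MonoidAlgebra.one_def, MonoidAlgebra.smul_single, complexToSkew_single,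
    smul_eq_mul, mul_one]
  rfl

variable (W : Type*) [AddCommGroup W] [Module (SkewGroupAlgebra π) W]

/-- Compatibility of a `ℂ`-structure and a `ℂG`-structure with a `ℂ ∗ Ĝ`-structure. -/
class IsSkewRestriction [Module ℂ W] [Module (MonoidAlgebra ℂ π.ker) W] : Prop where
  smul_eq : ∀ (c : ℂ) (x : W), c • x = skewSingle π 1 c • x
  of_smul_eq : ∀ (g : π.ker) (x : W), MonoidAlgebra.of ℂ π.ker g • x = skewSingle π g 1 • x

variable {π W} [Module ℂ W] [Module (MonoidAlgebra ℂ π.ker) W] [IsSkewRestriction π W]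

theorem skewSingle_even_smul (g : π.ker) (c : ℂ) (x : W) :
    skewSingle π g c • x = c • MonoidAlgebra.of ℂ π.ker g • x := by
  rw [IsSkewRestriction.of_smul_eq, IsSkewRestriction.smul_eq (π := π) c, ← mul_smul,
    skewSingle_mul_one, one_mul]

variable [IsScalarTower ℂ (MonoidAlgebra ℂ π.ker) W]

theorem skewSingle_even_smul_mem (U : Submodule (MonoidAlgebra ℂ π.ker) W) {g : Gh} (hg : π g = 1)
    (c : ℂ) {x : W} (hx : x ∈ U) : skewSingle π g c • x ∈ U := by
  rw [skewSingle_even_smul ⟨g, hg⟩]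
  exact U.smul_of_tower_mem c (U.smul_mem _ hx)

/-- A submodule of a simple `ℂ ∗ Ĝ`-module generates it together with its odd translate. -/
theorem exists_add_odd_smul [IsSimpleModule (SkewGroupAlgebra π) W]
    {U : Submodule (MonoidAlgebra ℂ π.ker) W} (hU : U ≠ ⊥) {w : Gh} (hw : π w = -1) (x : W) :
    ∃ y ∈ U, ∃ z ∈ U, x = y + skewSingle π w 1 • z := by
  let N : Submodule (SkewGroupAlgebra π) W :=
    { carrier := {x | ∃ y ∈ U, ∃ z ∈ U, x = y + skewSingle π w 1 • z}
      add_mem' := by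
        rintro _ _ ⟨y, hy, z, hz, rfl⟩ ⟨y', hy', z', hz', rfl⟩
        exact ⟨y + y', U.add_mem hy hy', z + z', U.add_mem hz hz', by rw [smul_add]; abel⟩
      zero_mem' := ⟨0, U.zero_mem, 0, U.zero_mem, by rw [smul_zero, add_zero]⟩
      smul_mem' := by
        intro a x hx
        induction a using skew_induction with
        | hs g c =>
          obtain ⟨y, hy, z, hz, rfl⟩ := hx
          rcases Int.units_eq_one_or (π g) with hg | hg
          -- Even `g` is moved past `w` by `g w = w (w⁻¹ g w)`, which conjugates its coefficient; an
          -- odd `g`, below, exchanges the two summands.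
          · refine ⟨_, skewSingle_even_smul_mem U hg c hy, _,
              skewSingle_even_smul_mem U (g := w⁻¹ * g * w) (by simp [hw, hg])
                ((starRingEnd ℂ) c) hz, ?_⟩
            rw [smul_add, ← mul_smul, ← mul_smul, skewSingle_mul_one, skewSingle_mul_of_odd hw]
            simp [mul_assoc]
          · refine ⟨_, skewSingle_even_smul_mem U (g := g * w) (by simp [hw, hg]) c hz, _,
              skewSingle_even_smul_mem U (g := w⁻¹ * g) (by simp [hw, hg])
                ((starRingEnd ℂ) c) hy, ?_⟩
            rw [smul_add, ← mul_smul, ← mul_smul, skewSingle_mul_one, skewSingle_mul_of_odd hw,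
              add_comm]
            simp
        | ha a b ha hb =>
          obtain ⟨y, hy, z, hz, e⟩ := ha
          obtain ⟨y', hy', z', hz', e'⟩ := hb
          exact ⟨y + y', U.add_mem hy hy', z + z', U.add_mem hz hz', by
            rw [add_smul, e, e', smul_add]; abel⟩ }
  have hN : N = ⊤ := by
    refine (eq_bot_or_eq_top N).resolve_left fun h => hU ?_
    rw [eq_bot_iff]
    intro y hy
    have : y ∈ N := ⟨y, hy, 0, U.zero_mem, by rw [smul_zero, add_zero]⟩
    rwa [h] at this
  have : x ∈ N := by rw [hN]; trivial
  exact this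

/-- `U ∩ w⁻¹U` is a `ℂG`-submodule of the simple module `U`. Were it all of `U`, then `wU ⊆ U` and
`W = U + wU = U`. -/
theorem eq_zero_of_mem_of_odd_smul_mem [IsSimpleModule (SkewGroupAlgebra π) W]
    {U : Submodule (MonoidAlgebra ℂ π.ker) W} [hs : IsSimpleModule (MonoidAlgebra ℂ π.ker) U]
    (hU : U ≠ ⊤) {w : Gh} (hw : π w = -1) {x : W} (hx : x ∈ U)
    (hwx : skewSingle π w 1 • x ∈ U) : x = 0 := by
  have hU0 : IsAtom U := isSimpleModule_iff_isAtom.1 hs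
  let N : Submodule (MonoidAlgebra ℂ π.ker) W :=
    { carrier := {x | x ∈ U ∧ skewSingle π w 1 • x ∈ U}
      add_mem' := fun {x y} hx hy => ⟨U.add_mem hx.1 hy.1, by
        rw [smul_add]; exact U.add_mem hx.2 hy.2⟩
      zero_mem' := ⟨U.zero_mem, by rw [smul_zero]; exact U.zero_mem⟩
      smul_mem' := by
        intro a x hx
        refine ⟨U.smul_mem a hx.1, ?_⟩
        induction a using MonoidAlgebra.induction_on with
        | of g =>
          have := skewSingle_even_smul_mem U (g := w * g * w⁻¹)
            (by simp [MonoidHom.mem_ker.1 g.2]) 1 hx.2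
          rw [← mul_smul, skewSingle_mul_one, inv_mul_cancel_right] at this
          rwa [IsSkewRestriction.of_smul_eq, ← mul_smul, skewSingle_mul_one]
        | add a b ha hb => rw [add_smul, smul_add]; exact U.add_mem ha hb
        | smul c a ha =>
          have := skewSingle_even_smul_mem U (map_one π) ((starRingEnd ℂ) c) ha
          rw [← mul_smul, skewSingle_mul_one] at this
          rw [smul_assoc, IsSkewRestriction.smul_eq (π := π), ← mul_smul, skewSingle_mul_of_odd hw]
          simpa using this }
  have hNU : N ≤ U := fun x hx => hx.1
  rcases hU0.le_iff.1 hNU with h | h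
  · have : x ∈ N := ⟨hx, hwx⟩
    rwa [h] at this
  · refine absurd (eq_top_iff.2 fun y _ => ?_) hU
    obtain ⟨y, hy, z, hz, rfl⟩ := exists_add_odd_smul hU0.1 hw y
    rw [← h] at hz
    exact U.add_mem hy hz.2

/-- If `W` were simple over `ℂG`, Schur's lemma would put the commutant inside `ℂ`, making it
commutative. -/
theorem not_isOfType_quaternion [Finite Gh] [Module ℝ W]
    [IsScalarTower ℝ (SkewGroupAlgebra π) W] [IsSimpleModule (MonoidAlgebra ℂ π.ker) W] :
    ¬ IsOfType π W (Quaternion ℝ) := by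
  rintro ⟨f⟩
  have scal : ∀ Y : Module.End (SkewGroupAlgebra π) W, ∃ c : ℂ, ∀ x, Y x = c • x := fun Y => by
    let X : Module.End ℂ W :=
      { toFun := Y, map_add' := map_add Y, map_smul' := fun c x => by
          rw [IsSkewRestriction.smul_eq (π := π), map_smul, RingHom.id_apply,
            IsSkewRestriction.smul_eq (π := π) c] }
    obtain ⟨c, hc⟩ := exists_eq_smul_one_of_commute (G := π.ker) X fun g => by
      ext x
      change MonoidAlgebra.of ℂ π.ker g • Y x = Y (MonoidAlgebra.of ℂ π.ker g • x)
      rw [IsSkewRestriction.of_smul_eq, IsSkewRestriction.of_smul_eq, map_smul]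
    exact ⟨c, fun x => LinearMap.congr_fun hc x⟩
  have hcomm : ∀ Y Z : Module.End (SkewGroupAlgebra π) W, Y * Z = Z * Y := fun Y Z => by
    obtain ⟨c, hc⟩ := scal Y
    obtain ⟨d, hd⟩ := scal Z
    ext x
    rw [Module.End.mul_apply, Module.End.mul_apply, hc, hd, hd, hc, smul_comm]
  have hcomm' : ∀ a b : Quaternion ℝ, a * b = b * a := fun a b => by
    have := congrArg f (hcomm (f.symm a) (f.symm b))
    rwa [map_mul, map_mul, f.apply_symm_apply, f.apply_symm_apply] at this
  obtain ⟨a, b, hab⟩ := Quaternion.exists_mul_ne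
  exact hab (hcomm' a b)

variable [Module ℝ W] [IsScalarTower ℝ ℂ W]

variable [IsScalarTower ℝ (SkewGroupAlgebra π) W]

theorem realToComplex_smul_eq (c : MonoidAlgebra ℝ π.ker) (x : W) :
    realToComplex π.ker c • x = realToSkew π (evenToReal π c) • x := by
  induction c using MonoidAlgebra.induction_on with
  | of g => rw [realToComplex_of, evenToSkew_of, IsSkewRestriction.of_smul_eq]
  | add a b ha hb => rw [map_add, map_add, map_add, add_smul, add_smul, ha, hb]
  | smul r a ha =>
    rw [map_smul, map_smul, map_smul, smul_assoc r (realToSkew π _),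
      ← algebraMap_smul ℂ r (realToComplex π.ker a),
      smul_assoc, ha, algebraMap_smul]

/-- Over `ℝ` one has `W = U ⊕ wU`, and multiplication by `w` is injective and `ℝ`-linear. -/
theorem finrank_eq_two_mul_finrank [IsSimpleModule (SkewGroupAlgebra π) W] [FiniteDimensional ℝ W]
    {U : Submodule (MonoidAlgebra ℂ π.ker) W} [hs : IsSimpleModule (MonoidAlgebra ℂ π.ker) U]
    (hU : U ≠ ⊤) {w : Gh} (hw : π w = -1) :
    Module.finrank ℝ W = 2 * (2 * Module.finrank ℂ U) := by
  let Ur : Submodule ℝ W := (U.restrictScalars ℂ).restrictScalars ℝ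
  have hinj : Function.Injective (skewAction π W w 1) := fun x y h => by
    have := congrArg (skewSingle π w⁻¹ 1 • ·) h
    simp only [skewAction_apply] at this
    rwa [← mul_smul, ← mul_smul, skewSingle_mul_one, inv_mul_cancel, skewSingle_one, one_smul,
      one_smul] at this
  have hw' : π w⁻¹ = -1 := by rw [map_inv, hw]; rfl
  have hc : IsCompl Ur (Ur.map (skewAction π W w 1)) := by
    constructor
    · rw [Submodule.disjoint_def]
      rintro _ hx ⟨y, hy, rfl⟩
      rw [eq_zero_of_mem_of_odd_smul_mem hU hw hy hx, map_zero]
    · rw [codisjoint_iff, eq_top_iff]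
      intro x _
      obtain ⟨y, hy, z, hz, rfl⟩ :=
        exists_add_odd_smul (isSimpleModule_iff_isAtom.1 hs).1 hw x
      exact Submodule.add_mem_sup hy ⟨z, hz, rfl⟩
  have h1 := Submodule.finrank_add_eq_of_isCompl hc
  have h2 : Module.finrank ℝ (Ur.map (skewAction π W w 1)) = Module.finrank ℝ Ur :=
    (Submodule.equivMapOfInjective _ hinj Ur).finrank_eq.symm
  have h3 : Module.finrank ℝ Ur = 2 * Module.finrank ℂ U :=
    (Module.finrank_mul_finrank ℝ ℂ (U.restrictScalars ℂ)).symm.trans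
      (by rw [Complex.finrank_real_complex]; rfl)
  rw [← h1, h2, h3, two_mul (2 * _)]

/-- For proper `U`, let `p` be a `ℂG`-projection onto `U` and `q = w p w⁻¹`. Odd elements
interchange `p` and `q`, and anticommute with `i`, so `p + q` and `i (p - q)` both lie in the
commutant. If that is `ℝ`, then `p` is a complex scalar, which no projection onto a proper nonzero
subspace is. -/
theorem eq_top_of_isOfType_real [Finite Gh] [IsSimpleModule (SkewGroupAlgebra π) W]
    {U : Submodule (MonoidAlgebra ℂ π.ker) W} [hs : IsSimpleModule (MonoidAlgebra ℂ π.ker) U]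
    {w : Gh} (hw : π w = -1) (h : IsOfType π W ℝ) : U = ⊤ := by
  by_contra hU
  obtain ⟨Q, hQ⟩ := exists_isCompl U
  obtain ⟨u, hu, hu0⟩ := U.ne_bot_iff.1 (isSimpleModule_iff_isAtom.1 hs).1
  obtain ⟨x, hx, hx0⟩ := Q.ne_bot_iff.1 (fun h => hU (by simpa [h] using hQ.sup_eq_top))
  let P : W →ₗ[MonoidAlgebra ℂ π.ker] W := U.subtype ∘ₗ U.projectionOnto Q hQ
  let p : Module.End ℝ W :=
    { toFun := P, map_add' := map_add P, map_smul' := fun r y => by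
        rw [← algebraMap_smul ℂ r y, P.map_smul_of_tower, algebraMap_smul]; rfl }
  have hpu : p u = u := congrArg Subtype.val (Submodule.projectionOnto_apply_left hQ ⟨u, hu⟩)
  have hpx : p x = 0 := congrArg Subtype.val (Submodule.projectionOnto_apply_right hQ ⟨x, hx⟩)
  have hpe : ∀ g, π g = 1 → ∀ a, skewAction π W g a * p = p * skewAction π W g a := fun g hg a => by
    ext y
    change skewSingle π g a • P y = P (skewSingle π g a • y)
    rw [skewSingle_even_smul ⟨g, hg⟩, skewSingle_even_smul ⟨g, hg⟩, P.map_smul_of_tower, P.map_smul]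
  let q : Module.End ℝ W := skewAction π W w 1 * p * skewAction π W w⁻¹ 1
  have hw' : π w⁻¹ = -1 := by rw [map_inv, hw]; rfl
  have hpo : ∀ g, π g = -1 → ∀ a, skewAction π W g a * p = q * skewAction π W g a := fun g hg a => by
    have e1 : skewAction π W g a =
        skewAction π W w 1 * skewAction π W (w⁻¹ * g) ((starRingEnd ℂ) a) := by
      rw [skewAction_mul_of_odd hw]; simp
    have e2 : skewAction π W w⁻¹ 1 * skewAction π W g a =
        skewAction π W (w⁻¹ * g) ((starRingEnd ℂ) a) := by
      rw [skewAction_mul_of_odd hw', one_mul]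
    rw [mul_assoc _ _ (skewAction π W g a), e2, e1, mul_assoc, hpe _ (by simp [hw, hg]), mul_assoc]
  have hqe : ∀ g, π g = 1 → ∀ a, skewAction π W g a * q = q * skewAction π W g a := fun g hg a => by
    have e1 : skewAction π W g a * skewAction π W w 1 =
        skewAction π W w 1 * skewAction π W (w⁻¹ * g * w) ((starRingEnd ℂ) a) := by
      rw [skewAction_mul_of_odd hw, skewAction_mul_of_even hg]; simp [mul_assoc]
    have e2 : skewAction π W w⁻¹ 1 * skewAction π W g a =
        skewAction π W (w⁻¹ * g * w) ((starRingEnd ℂ) a) * skewAction π W w⁻¹ 1 := by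
      rw [skewAction_mul_of_odd hw', skewAction_mul_of_even (by simp [hw, hg])]; simp
    rw [mul_assoc _ _ (skewAction π W g a), e2, ← mul_assoc, ← mul_assoc, e1,
      mul_assoc _ _ p, hpe _ (by simp [hw, hg])]
    simp only [mul_assoc]
  have hqo : ∀ g, π g = -1 → ∀ a, skewAction π W g a * q = p * skewAction π W g a := fun g hg a => by
    have e1 : skewAction π W g a * skewAction π W w 1 = skewAction π W (g * w) a := by
      rw [skewAction_mul_of_odd hg]; simp
    have e2 : skewAction π W (g * w) a * skewAction π W w⁻¹ 1 = skewAction π W g a := by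
      rw [skewAction_mul_of_even (by simp [hw, hg])]; simp
    rw [← mul_assoc, ← mul_assoc, e1, hpe _ (by simp [hw, hg]), mul_assoc, e2]
  let J : Module.End ℝ W := skewAction π W 1 Complex.I
  have hJe : ∀ g, π g = 1 → ∀ a, skewAction π W g a * J = J * skewAction π W g a := fun g hg a => by
    rw [skewAction_mul_of_even hg, skewAction_mul_of_even (map_one π), mul_one, one_mul, mul_comm a]
  have hJo : ∀ g, π g = -1 → ∀ a, skewAction π W g a * J = -(J * skewAction π W g a) :=
    fun g hg a => by
      rw [skewAction_mul_of_odd hg, skewAction_mul_of_even (map_one π), mul_one, one_mul,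
        mul_comm a, Complex.conj_I, neg_mul, skewAction_neg]
  have hJJ : J * J = -1 := by
    rw [skewAction_mul_of_even (map_one π), Complex.I_mul_I, skewAction_neg, one_mul, skewAction_one]
  have h1 : p + q ∈ Subalgebra.centralizer ℝ (Set.range (skewFamily π W)) := by
    rw [Subalgebra.mem_centralizer_iff]
    rintro _ ⟨k, rfl⟩
    rcases Int.units_eq_one_or (π k.1) with hg | hg
    · rw [skewFamily, mul_add, add_mul, hpe _ hg, hqe _ hg]
    · rw [skewFamily, mul_add, add_mul, hpo _ hg, hqo _ hg, add_comm]
  have h2 : J * (p - q) ∈ Subalgebra.centralizer ℝ (Set.range (skewFamily π W)) := by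
    rw [Subalgebra.mem_centralizer_iff]
    rintro _ ⟨k, rfl⟩
    rcases Int.units_eq_one_or (π k.1) with hg | hg
    · rw [skewFamily, ← mul_assoc, hJe _ hg, mul_assoc, mul_assoc, mul_sub, hpe _ hg, hqe _ hg,
        sub_mul]
    · rw [skewFamily, ← mul_assoc, hJo _ hg, neg_mul, mul_assoc, mul_assoc, mul_sub, hpo _ hg,
        hqo _ hg, sub_mul, ← mul_neg, neg_sub]
  obtain ⟨f⟩ := h
  have scal : ∀ Y ∈ Subalgebra.centralizer ℝ (Set.range (skewFamily π W)),
      ∃ r : ℝ, Y = r • 1 := fun Y hY => by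
    have e := (commutantEquiv π W).trans f
    refine ⟨e ⟨Y, hY⟩, ?_⟩
    have h3 : (⟨Y, hY⟩ : Subalgebra.centralizer ℝ (Set.range (skewFamily π W))) =
        algebraMap ℝ _ (e ⟨Y, hY⟩) := by
      apply e.injective
      rw [e.commutes]
      rfl
    exact (congrArg Subtype.val h3).trans (Algebra.algebraMap_eq_smul_one _)
  obtain ⟨r, hr⟩ := scal _ h1
  obtain ⟨s, hs⟩ := scal _ h2
  have h3 : p - q = -(s • J) := by
    have : J * (J * (p - q)) = J * (s • 1) := by rw [hs]
    rw [← mul_assoc, hJJ, neg_one_mul, mul_smul_comm, mul_one] at this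
    rw [← this, neg_neg]
  -- Adding `p + q = r` and `p - q = -s i`; evaluation at `x ∈ Q` and at `u ∈ U` then gives the
  -- contradiction.
  have h4 : p + p = r • 1 - s • J := by
    rw [← hr, sub_eq_add_neg, ← h3]; abel
  have h5 : ∀ y, p y + p y = ((r : ℂ) - s * Complex.I) • y := fun y => by
    have e1 := LinearMap.congr_fun h4 y
    have e2 : J y = Complex.I • y := (IsSkewRestriction.smul_eq (π := π) Complex.I y).symm
    rw [LinearMap.add_apply, LinearMap.sub_apply, LinearMap.smul_apply, LinearMap.smul_apply, e2,
      Module.End.one_apply, ← algebraMap_smul ℂ r, ← algebraMap_smul ℂ s, ← mul_smul,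
      ← sub_smul] at e1
    exact e1
  have h6 := h5 x
  rw [hpx, add_zero, eq_comm, smul_eq_zero] at h6
  have h7 := h5 u
  rw [h6.resolve_right hx0, zero_smul, hpu, ← two_smul ℂ, smul_eq_zero] at h7
  exact hu0 (h7.resolve_left two_ne_zero)

end ComplexStructure

/-! ### Dimension comparison and the criterion -/

section Criterion

variable {Gh : Type*} [Group Gh] [Fintype Gh] {π : Gh →* ℤˣ}

theorem card_eq_two_mul_card_ker (hπ : Function.Surjective π) :
    Fintype.card Gh = 2 * Nat.card π.ker := by
  have h := Subgroup.card_mul_index π.ker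
  rw [Subgroup.index_ker, MonoidHom.range_eq_top.2 hπ, Subgroup.card_top,
    Nat.card_eq_fintype_card (α := ℤˣ), Fintype.card_units_int] at h
  rw [← Nat.card_eq_fintype_card, ← h, mul_comm]

/-- If the sum of the squares of the odd elements acts by `r` on `V`, then the indicator of the
character of `V` is `r dim V / |G|`. -/
theorem realFSIndicator_eq {V : Type*} [AddCommGroup V] [Module ℂ V]
    [Module (MonoidAlgebra ℂ π.ker) V] [IsScalarTower ℂ (MonoidAlgebra ℂ π.ker) V]
    [IsSimpleModule (MonoidAlgebra ℂ π.ker) V] {r : ℝ}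
    (h : ∀ v : V, realToComplex π.ker (oddSquareSum π) • v = (r : ℂ) • v) :
    realFSIndicator π (moduleCharacter π.ker V) =
      ((r * Module.finrank ℂ V / Nat.card π.ker : ℝ) : ℂ) := by
  have := IsSimpleModule.finiteDimensional_complex (G := π.ker) (U := V)
  have h1 : ∑ z : Gh with π z = -1, groupAction π.ker V (sqEven π z) = (r : ℂ) • 1 := by
    ext v
    have := h v
    simp only [oddSquareSum, map_sum, realToComplex_of, Finset.sum_smul] at this
    rw [LinearMap.sum_apply]
    exact this
  have h2 := congrArg (LinearMap.trace ℂ V) h1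
  rw [map_sum, map_smul, LinearMap.trace_one, smul_eq_mul] at h2
  rw [realFSIndicator]
  simp only [moduleCharacter_eq]
  rw [h2]
  push_cast
  ring

variable {V : Type*} [AddCommGroup V] [Module ℂ V] [Module (MonoidAlgebra ℂ π.ker) V]
  [IsScalarTower ℂ (MonoidAlgebra ℂ π.ker) V] [IsSimpleModule (MonoidAlgebra ℂ π.ker) V]
  {W : Type*} [AddCommGroup W] [Module ℝ W] [Module (SkewGroupAlgebra π) W]
  [IsScalarTower ℝ (SkewGroupAlgebra π) W] [IsSimpleModule (SkewGroupAlgebra π) W]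

/-- Simple constituents of `W` have the same dimension as `V`. -/
theorem InSameABlock.finrank_eq [Module ℂ W] [Module (MonoidAlgebra ℂ π.ker) W]
    [IsScalarTower ℂ (MonoidAlgebra ℂ π.ker) W] [IsScalarTower ℝ ℂ W] [IsSkewRestriction π W]
    (h : InSameABlock π V W) (U : Submodule (MonoidAlgebra ℂ π.ker) W)
    [hs : IsSimpleModule (MonoidAlgebra ℂ π.ker) U] :
    Module.finrank ℂ U = Module.finrank ℂ V := by
  have : Nontrivial W := IsSimpleModule.nontrivial (SkewGroupAlgebra π) W
  have : Nontrivial V := IsSimpleModule.nontrivial (MonoidAlgebra ℂ π.ker) V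
  have : Nontrivial U := IsSimpleModule.nontrivial (MonoidAlgebra ℂ π.ker) U
  have : FiniteDimensional ℂ V := IsSimpleModule.finiteDimensional_complex (G := π.ker)
  have : FiniteDimensional ℂ U := IsSimpleModule.finiteDimensional_complex (G := π.ker)
  let : Fintype π.ker := Fintype.ofFinite _
  obtain ⟨u, hu⟩ := exists_ne (0 : U)
  obtain ⟨v, hv⟩ := exists_ne (0 : V)
  have h1 := congrArg Subtype.val (commutatorSum_smul (G := π.ker) u)
  have h2 : realToSkew π (evenToReal π (commutatorSum π.ker)) • (u : W) =
      (((Fintype.card π.ker : ℝ) / Module.finrank ℂ U) ^ 2 : ℝ) • (u : W) := by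
    rw [← realToComplex_smul_eq, ← algebraMap_smul ℂ]
    refine h1.trans ?_
    simp
  have h3 := h.smul_eq conjReal_commutatorSum
    (smul_eq_of_exists_smul_eq conjReal_commutatorSum (by simpa using hu) h2) v
  rw [commutatorSum_smul] at h3
  -- The scalars `(|G| / dim)²` for `V` and `U` agree, and dimensions are positive.
  have h4 := smul_left_injective ℂ hv h3
  have hG : (0 : ℝ) < Fintype.card π.ker := Nat.cast_pos.2 Fintype.card_pos
  have hU : (0 : ℝ) < Module.finrank ℂ U := Nat.cast_pos.2 Module.finrank_pos
  have hV : (0 : ℝ) < Module.finrank ℂ V := Nat.cast_pos.2 Module.finrank_pos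
  have h5 : ((Fintype.card π.ker : ℝ) / Module.finrank ℂ V) ^ 2 =
      ((Fintype.card π.ker : ℝ) / Module.finrank ℂ U) ^ 2 := by
    apply Complex.ofReal_injective
    rw [← h4]
    push_cast
    rfl
  have h6 := (pow_left_inj₀ (div_pos hG hV).le (div_pos hG hU).le two_ne_zero).1 h5
  rw [div_eq_div_iff hV.ne' hU.ne', mul_right_inj' hG.ne'] at h6
  exact_mod_cast h6

theorem InSameABlock.finrank_real (hπ : Function.Surjective π) (h : InSameABlock π V W) :
    (IsOfType π W ℝ → Module.finrank ℝ W = 2 * Module.finrank ℂ V) ∧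
    (IsOfType π W (Quaternion ℝ) → Module.finrank ℝ W = 2 * (2 * Module.finrank ℂ V)) := by
  have := finiteDimensional_of_isSimpleModule_skew (π := π) (W := W)
  let : Module ℂ W := Module.compHom W (complexScalarToSkew π)
  let : Module (MonoidAlgebra ℂ π.ker) W := Module.compHom W (complexToSkew π)
  have : IsScalarTower ℂ (MonoidAlgebra ℂ π.ker) W := ⟨fun c a x => by
    change complexToSkew π (c • a) • x = complexScalarToSkew π c • complexToSkew π a • x
    rw [complexToSkew_smul, mul_smul]⟩
  have : IsScalarTower ℝ ℂ W := ⟨fun r c x => by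
    change skewSingle π 1 (r • c) • x = r • skewSingle π 1 c • x
    rw [← smul_assoc, smul_skewSingle, Complex.real_smul]⟩
  have : IsSkewRestriction π W := ⟨fun c x => rfl, fun g x => by
    rw [← complexToSkew_single]
    rfl⟩
  have : Nontrivial W := IsSimpleModule.nontrivial (SkewGroupAlgebra π) W
  obtain ⟨w, hw⟩ := hπ (-1)
  obtain ⟨U, hs⟩ := IsSemisimpleModule.exists_simple_submodule (MonoidAlgebra ℂ π.ker) W
  rw [← h.finrank_eq U]
  refine ⟨fun hR => ?_, fun hH => finrank_eq_two_mul_finrank (U := U) (fun hU => ?_) hw⟩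
  · obtain rfl := eq_top_of_isOfType_real (U := U) hw hR
    rw [← Module.finrank_mul_finrank ℝ ℂ W, Complex.finrank_real_complex]
    congr 1
    exact (finrank_top ℂ W).symm
  · subst hU
    have := IsSimpleModule.congr (Submodule.topEquiv (R := MonoidAlgebra ℂ π.ker) (M := W)).symm
    exact not_isOfType_quaternion hH

end Criterion

theorem mainTheorem4 {Gh : Type*} [Group Gh] [Fintype Gh] (π : Gh →* ℤˣ)
    (hπ : Function.Surjective π)
    (V : Type*) [AddCommGroup V] [Module ℂ V] [Module (MonoidAlgebra ℂ π.ker) V]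
    [IsScalarTower ℂ (MonoidAlgebra ℂ π.ker) V] [IsSimpleModule (MonoidAlgebra ℂ π.ker) V]
    (W : Type*) [AddCommGroup W] [Module ℝ W] [Module (SkewGroupAlgebra π) W]
    [IsScalarTower ℝ (SkewGroupAlgebra π) W] [IsSimpleModule (SkewGroupAlgebra π) W]
    (hVW : InSameABlock π V W) :
    (IsOfType π W ℝ ∨ IsOfType π W ℂ ∨ IsOfType π W (Quaternion ℝ)) ∧
    (IsOfType π W ℝ → realFSIndicator π (moduleCharacter π.ker V) = 1) ∧
    (IsOfType π W ℂ → realFSIndicator π (moduleCharacter π.ker V) = 0) ∧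
    (IsOfType π W (Quaternion ℝ) → realFSIndicator π (moduleCharacter π.ker V) = -1) := by
  obtain ⟨htype, r, hr, hdim⟩ := skew_frobeniusSchur (π := π) (W := W)
  have : Nontrivial W := IsSimpleModule.nontrivial (SkewGroupAlgebra π) W
  have := finiteDimensional_of_isSimpleModule_skew (π := π) (W := W)
  have hW : (Module.finrank ℝ W : ℝ) ≠ 0 := Nat.cast_ne_zero.2 Module.finrank_pos.ne'
  have hG : (Nat.card π.ker : ℝ) ≠ 0 := Nat.cast_ne_zero.2 Nat.card_pos.ne'
  rw [realFSIndicator_eq (hVW.smul_eq conjReal_oddSquareSum hr)]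
  rw [card_eq_two_mul_card_ker hπ] at hdim
  push_cast at hdim
  obtain ⟨hR, hH⟩ := hVW.finrank_real hπ
  refine ⟨htype, fun h => ?_, fun h => ?_, fun h => ?_⟩
  · have hd := h.some.toLinearEquiv.finrank_eq
    rw [Module.finrank_self] at hd
    rw [hR h, hd] at hdim
    push_cast at hdim
    have : r * Module.finrank ℂ V = Nat.card π.ker := by linarith
    rw [this, div_self hG, Complex.ofReal_one]
  -- Here `2 - dim D = 0`, so `r = 0` without any comparison of dimensions.
  · have hd := h.some.toLinearEquiv.finrank_eq
    rw [Complex.finrank_real_complex] at hd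
    rw [hd] at hdim
    push_cast at hdim
    rw [sub_self, mul_zero] at hdim
    rw [(mul_eq_zero.1 hdim).resolve_right hW, zero_mul, zero_div, Complex.ofReal_zero]
  · have hd := h.some.toLinearEquiv.finrank_eq
    rw [Quaternion.finrank_eq_four] at hd
    rw [hH h, hd] at hdim
    push_cast at hdim
    have : r * Module.finrank ℂ V = -Nat.card π.ker := by linarith
    rw [this, neg_div, div_self hG, Complex.ofReal_neg, Complex.ofReal_one]
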